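/- Let $\mathbb{S}\mathsf{MC}$ be the 2-category whose objects are symmetric monoidal categories, whose 1-morphisms are strong symmetric monoidal functors (functors $F$ with natural coherence isomorphisms $I\cong F(I)$ and $F(c)\otimes F(c')\cong F(c\otimes c')$ compatible with the associators, unitors and braidings), and whose 2-morphisms are monoidal natural transformations. Let $J$ be a (small) set and let $(\mathcal{C}_j)_{j\in J}$ be a family of symmetric monoidal categories, with monoidal units $I_j$. (1) Let $\prod_{j}\mathcal{C}_j$ be the product category with the pointwise symmetric monoidal structure, and let $\pi_j$ be the projections, which are strict monoidal. This is a strict product in $\mathbb{S}\mathsf{MC}$: for every symmetric monoidal category $\mathcal{X}$, composition with the $\pi_j$ is an isomorphism of categories $$\mathbb{S}\mathsf{MC}\Big(\mathcal{X},\prod_{j\in J}\mathcal{C}_j\Big)\;\cong\;\prod_{j\in J}\mathbb{S}\mathsf{MC}(\mathcal{X},\mathcal{C}_j).$$ (2) Let $\bigsqcup_j\mathcal{C}_j$ be the following symmetric monoidal category. Its objects are the families $c=(c_j)_{j\in J}$ of objects $c_j\in\mathcal{C}_j$ with $c_j=I_j$ for all but finitely many $j$; its morphisms $c\to d$ are the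 families of morphisms $f_j\colon c_j\to d_j$ such that, for all but finitely many $j$, $c_j=d_j=I_j$ and $f_j=\mathrm{id}_{I_j}$. The unit is $(I_j)_j$, and the monoidal product and coherence isomorphisms are given pointwise, except that $I_j\otimes I_j$ is replaced by $I_j$ (along the unitor). Let $\mathrm{inc}_j\colon\mathcal{C}_j\to\bigsqcup_{j}\mathcal{C}_j$ be the strong symmetric monoidal functor that sends $c$ to the family with $c$ in position $j$ and the unit in every other position. This is a 2-categorical coproduct in $\mathbb{S}\mathsf{MC}$: for every symmetric monoidal category $\mathcal{X}$, composition with the $\mathrm{inc}_j$ is an equivalence of categories $$\mathbb{S}\mathsf{MC}\Big(\bigsqcup_{j\in J}\mathcal{C}_j,\mathcal{X}\Big)\;\simeq\;\prod_{j\in J}\mathbb{S}\mathsf{MC}(\mathcal{C}_j,\mathcal{X}).$$ In particular $\mathbb{S}\mathsf{MC}$ has all small products and coproducts, and products are strict. -/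

import Mathlib

open CategoryTheory MonoidalCategory

universe w v u

set_option linter.unusedSimpArgs false
set_option linter.checkUnivs false

/-! ## The 2-category of symmetric monoidal categories -/

/-- A (bundled) symmetric monoidal category. -/
structure SymMonCat : Type (max (u + 1) (v + 1)) where
  carrier : Type u
  [category : Category.{v} carrier]
  [monoidal : MonoidalCategory carrier]
  [symmetric : SymmetricCategory carrier]

namespace SymMonCat

instance : CoeSort SymMonCat.{v, u} (Type u) := ⟨carrier⟩

attribute [instance] category monoidal symmetric

/-- A strong symmetric monoidal functor: a functor together with invertible coherence morphisms
`𝟙_ ≅ F 𝟙_` and `F X ⊗ F Y ≅ F (X ⊗ Y)` that are natural and compatible with the associators,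
the unitors and the braidings. -/
structure StrongFunctor (C D : SymMonCat.{v, u}) where
  functor : C ⥤ D
  [braided : functor.Braided]

attribute [instance] StrongFunctor.braided

/-- A monoidal natural transformation between strong symmetric monoidal functors. -/
structure MonoidalTrans {C D : SymMonCat.{v, u}} (F G : StrongFunctor C D) where
  natTrans : F.functor ⟶ G.functor
  [isMonoidal : NatTrans.IsMonoidal natTrans]

attribute [instance] MonoidalTrans.isMonoidal

/-- The category of strong symmetric monoidal functors and monoidal natural transformations. -/
instance (C D : SymMonCat.{v, u}) : Category (StrongFunctor C D) where
  Hom F G := MonoidalTrans F G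
  id F := { natTrans := 𝟙 F.functor }
  comp α β := { natTrans := α.natTrans ≫ β.natTrans }
  id_comp α := by cases α; simp
  comp_id α := by cases α; simp
  assoc α β γ := by simp

section

variable {C D : SymMonCat.{v, u}}

@[ext]
lemma trans_ext {F G : StrongFunctor C D} {α β : F ⟶ G}
    (h : ∀ X, α.natTrans.app X = β.natTrans.app X) : α = β := by
  obtain ⟨α⟩ := α
  obtain ⟨β⟩ := β
  obtain rfl : α = β := NatTrans.ext (funext h)
  rfl

@[simp]
lemma id_natTrans (F : StrongFunctor C D) : MonoidalTrans.natTrans (𝟙 F) = 𝟙 F.functor := rfl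

@[simp]
lemma comp_natTrans {F G H : StrongFunctor C D} (α : F ⟶ G) (β : G ⟶ H) :
    (α ≫ β).natTrans = α.natTrans ≫ β.natTrans := rfl

/-- A monoidal natural isomorphism of functors, as an isomorphism of strong functors. -/
def mkIso {F G : StrongFunctor C D} (e : F.functor ≅ G.functor)
    [m : NatTrans.IsMonoidal e.hom] : F ≅ G where
  hom := { natTrans := e.hom }
  inv := { natTrans := e.inv }
  hom_inv_id := by ext; simp
  inv_hom_id := by ext; simp

end

/-- The identity strong functor. -/
def idFunctor (C : SymMonCat.{v, u}) : StrongFunctor C C where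
  functor := 𝟭 C

/-- The composite of two strong functors, with the composite coherence morphisms. -/
def compFunctor {C D E : SymMonCat.{v, u}} (F : StrongFunctor C D) (G : StrongFunctor D E) :
    StrongFunctor C E where
  functor := F.functor ⋙ G.functor

/-- Whiskering of a monoidal transformation by a strong functor on the left. -/
def whiskerLeftTrans {C D E : SymMonCat.{v, u}} (F : StrongFunctor C D) {G H : StrongFunctor D E}
    (α : G ⟶ H) : compFunctor F G ⟶ compFunctor F H :=
  MonoidalTrans.mk (Functor.whiskerLeft F.functor α.natTrans)
    (isMonoidal := NatTrans.IsMonoidal.whiskerLeft _)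

/-- Whiskering of a monoidal transformation by a strong functor on the right. -/
def whiskerRightTrans {C D E : SymMonCat.{v, u}} {F G : StrongFunctor C D} (α : F ⟶ G)
    (H : StrongFunctor D E) : compFunctor F H ⟶ compFunctor G H :=
  MonoidalTrans.mk (Functor.whiskerRight α.natTrans H.functor)
    (isMonoidal := NatTrans.IsMonoidal.whiskerRight _)

section

variable {C D E E' : Type*} [Category* C] [Category* D] [Category* E] [Category* E']
  [MonoidalCategory C] [MonoidalCategory D] [MonoidalCategory E] [MonoidalCategory E']

lemma isMonoidal_leftUnitor (F : C ⥤ D) [F.LaxMonoidal] :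
    NatTrans.IsMonoidal F.leftUnitor.hom := inferInstance

lemma isMonoidal_rightUnitor (F : C ⥤ D) [F.LaxMonoidal] :
    NatTrans.IsMonoidal F.rightUnitor.hom := inferInstance

lemma isMonoidal_associator (F : C ⥤ D) (G : D ⥤ E) (H : E ⥤ E') [F.LaxMonoidal]
    [G.LaxMonoidal] [H.LaxMonoidal] :
    NatTrans.IsMonoidal (Functor.associator F G H).hom := inferInstance

end

/-- The 2-category of symmetric monoidal categories, strong symmetric monoidal functors and
monoidal natural transformations. -/
instance : Bicategory SymMonCat.{v, u} where
  Hom C D := StrongFunctor C D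
  id C := idFunctor C
  comp F G := compFunctor F G
  whiskerLeft F _ _ α := whiskerLeftTrans F α
  whiskerRight α F := whiskerRightTrans α F
  associator F G H := mkIso (F := compFunctor (compFunctor F G) H)
    (G := compFunctor F (compFunctor G H)) (Functor.associator F.functor G.functor H.functor)
    (m := isMonoidal_associator _ _ _)
  leftUnitor F := mkIso (F := compFunctor (idFunctor _) F) (G := F) F.functor.leftUnitor
    (m := isMonoidal_leftUnitor _)
  rightUnitor F := mkIso (F := compFunctor F (idFunctor _)) (G := F) F.functor.rightUnitor
    (m := isMonoidal_rightUnitor _)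
  whiskerLeft_id _ _ := by ext; simp [mkIso, compFunctor, idFunctor, whiskerLeftTrans, whiskerRightTrans]
  whiskerLeft_comp _ _ _ _ _ _ := by ext; simp [mkIso, compFunctor, idFunctor, whiskerLeftTrans, whiskerRightTrans]
  id_whiskerLeft _ := by ext; simp [mkIso, compFunctor, idFunctor, whiskerLeftTrans, whiskerRightTrans]
  comp_whiskerLeft _ _ _ _ _ := by ext; simp [mkIso, compFunctor, idFunctor, whiskerLeftTrans, whiskerRightTrans]
  id_whiskerRight _ _ := by ext; simp [mkIso, compFunctor, idFunctor, whiskerLeftTrans, whiskerRightTrans]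
  comp_whiskerRight _ _ _ := by ext; simp [mkIso, compFunctor, idFunctor, whiskerLeftTrans, whiskerRightTrans]
  whiskerRight_id _ := by ext; simp [mkIso, compFunctor, idFunctor, whiskerLeftTrans, whiskerRightTrans]
  whiskerRight_comp _ _ _ := by ext; simp [mkIso, compFunctor, idFunctor, whiskerLeftTrans, whiskerRightTrans]
  whisker_assoc _ _ _ _ _ := by ext; simp [mkIso, compFunctor, idFunctor, whiskerLeftTrans, whiskerRightTrans]
  whisker_exchange _ _ := by ext; simp [mkIso, compFunctor, idFunctor, whiskerLeftTrans, whiskerRightTrans]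
  pentagon _ _ _ _ := by ext; simp [mkIso, compFunctor, idFunctor, whiskerLeftTrans, whiskerRightTrans]
  triangle _ _ := by ext; simp [mkIso, compFunctor, idFunctor, whiskerLeftTrans, whiskerRightTrans]


lemma strongFunctor_ext {C D : SymMonCat.{v, u}} {F : C ⥤ D} (hF hG : F.Braided)
    (hε : hF.toLaxMonoidal.ε = hG.toLaxMonoidal.ε)
    (hμ : ∀ X Y, hF.toLaxMonoidal.μ X Y = hG.toLaxMonoidal.μ X Y) :
    StrongFunctor.mk F (braided := hF) = StrongFunctor.mk F (braided := hG) := by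
  have : hF.toMonoidal = hG.toMonoidal := by
    apply Functor.Monoidal.toLaxMonoidal_injective
    ext X Y
    · exact hε
    · exact hμ X Y
  cases hF
  cases hG
  dsimp only at this
  subst this
  rfl

lemma eqToHom_natTrans_app {C D : SymMonCat.{v, u}} {F G : StrongFunctor C D} (h : F = G) (X : C) :
    (MonoidalTrans.natTrans (eqToHom h)).app X = eqToHom (congrArg (fun K => K.functor.obj X) h) := by
  subst h
  rfl

lemma eq_eqToIso {C D : SymMonCat.{v, u}} {F G : StrongFunctor C D} (e : F ≅ G) (h : F = G)
    (w : ∀ X, e.hom.natTrans.app X = eqToHom (congrArg (fun K => K.functor.obj X) h)) :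
    e = eqToIso h := by
  apply Iso.ext
  apply trans_ext
  intro X
  rw [eqToIso.hom, eqToHom_natTrans_app, w]

open Functor.LaxMonoidal in
instance : Bicategory.Strict SymMonCat.{v, u} where
  id_comp {a b} F := strongFunctor_ext _ _
    (show ε F.functor ≫ F.functor.map (𝟙 (𝟙_ a)) = ε F.functor by simp)
    (fun X Y => show μ F.functor X Y ≫ F.functor.map (𝟙 (X ⊗ Y)) = μ F.functor X Y by simp)
  comp_id {a b} F := strongFunctor_ext _ _
    (show 𝟙 (𝟙_ b) ≫ ε F.functor = ε F.functor by simp)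
    (fun X Y => show 𝟙 (F.functor.obj X ⊗ F.functor.obj Y) ≫ μ F.functor X Y = μ F.functor X Y
      by simp)
  assoc F G H := strongFunctor_ext _ _
    (show ε H.functor ≫ H.functor.map (ε G.functor ≫ G.functor.map (ε F.functor)) =
      (ε H.functor ≫ H.functor.map (ε G.functor)) ≫ H.functor.map (G.functor.map (ε F.functor))
      by simp)
    (fun X Y => show μ H.functor _ _ ≫ H.functor.map (μ G.functor _ _ ≫
        G.functor.map (μ F.functor X Y)) =
      (μ H.functor _ _ ≫ H.functor.map (μ G.functor _ _)) ≫
        H.functor.map (G.functor.map (μ F.functor X Y)) by simp)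
  leftUnitor_eqToIso F := eq_eqToIso _ _ fun _ => rfl
  rightUnitor_eqToIso F := eq_eqToIso _ _ fun _ => rfl
  associator_eqToIso F G H := eq_eqToIso _ _ fun _ => rfl

end SymMonCat

/-! ## Strict products and coproducts in a 2-category -/

section Universal

open Bicategory

variable {B : Type*} [Bicategory B] {J : Type*}

/-- The functor `B(X, P) ⥤ ∏ j, B(X, A j)` given by composition with a family of 1-morphisms
`π j : P ⟶ A j`. -/
def coneComparison {A : J → B} {P : B} (π : ∀ j, P ⟶ A j) (X : B) :
    (X ⟶ P) ⥤ (∀ j, X ⟶ A j) :=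
  Functor.pi' fun j => postcomp X (π j)

/-- The functor `B(S, X) ⥤ ∏ j, B(A j, X)` given by composition with a family of 1-morphisms
`ι j : A j ⟶ S`. -/
def coconeComparison {A : J → B} {S : B} (ι : ∀ j, A j ⟶ S) (X : B) :
    (S ⟶ X) ⥤ (∀ j, A j ⟶ X) :=
  Functor.pi' fun j => precomp X (ι j)

/-- `P` with the projections `π j` is a strict product: for every object `X`, the functor
`B(X, P) ⥤ ∏ j, B(X, A j)` is an isomorphism of categories. -/
def IsStrictTwoProduct {A : J → B} {P : B} (π : ∀ j, P ⟶ A j) : Prop :=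
  ∀ X : B, ∃ G : (∀ j, X ⟶ A j) ⥤ (X ⟶ P),
    coneComparison π X ⋙ G = 𝟭 (X ⟶ P) ∧ G ⋙ coneComparison π X = 𝟭 (∀ j, X ⟶ A j)

/-- `S` with the coprojections `ι j` is a 2-coproduct: for every object `X`, the functor
`B(S, X) ⥤ ∏ j, B(A j, X)` is an equivalence of categories. -/
def IsTwoCoproduct {A : J → B} {S : B} (ι : ∀ j, A j ⟶ S) : Prop :=
  ∀ X : B, (coconeComparison ι X).IsEquivalence

end Universal

namespace SymMonCat

/-! ## Products -/

section Product

variable {J : Type w}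

/-- The pointwise monoidal structure on a product of categories. -/
instance piMonoidal (C : J → Type u) [∀ j, Category.{v} (C j)] [∀ j, MonoidalCategory (C j)] :
    MonoidalCategory (∀ j, C j) where
  tensorObj X Y j := X j ⊗ Y j
  whiskerLeft X _ _ f j := X j ◁ f j
  whiskerRight f Y j := f j ▷ Y j
  tensorHom f g j := f j ⊗ₘ g j
  tensorUnit j := 𝟙_ (C j)
  associator X Y Z := Pi.isoMk fun j => α_ (X j) (Y j) (Z j)
  leftUnitor X := Pi.isoMk fun j => λ_ (X j)
  rightUnitor X := Pi.isoMk fun j => ρ_ (X j)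
  tensorHom_def _ _ := by ext j; simp [MonoidalCategory.tensorHom_def]

/-- The pointwise symmetry on a product of symmetric monoidal categories. -/
instance piSymmetric (C : J → Type u) [∀ j, Category.{v} (C j)] [∀ j, MonoidalCategory (C j)]
    [∀ j, SymmetricCategory (C j)] : SymmetricCategory (∀ j, C j) where
  braiding X Y := Pi.isoMk fun j => β_ (X j) (Y j)

/-- The evaluation functors of a product are strict monoidal and preserve the symmetry. -/
instance piEvalBraided (C : J → Type u) [∀ j, Category.{v} (C j)] [∀ j, MonoidalCategory (C j)]
    [∀ j, SymmetricCategory (C j)] (j : J) : (Pi.eval C j).Braided where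
  toMonoidal := Functor.CoreMonoidal.toMonoidal
    { εIso := Iso.refl (𝟙_ (C j))
      μIso X Y := Iso.refl (X j ⊗ Y j)
      μIso_hom_natural_left f Y := (Category.comp_id (f j ▷ Y j)).trans (Category.id_comp _).symm
      μIso_hom_natural_right X f := (Category.comp_id (X j ◁ f j)).trans (Category.id_comp _).symm
      associativity X Y Z := show 𝟙 (X j ⊗ Y j) ▷ Z j ≫ 𝟙 ((X j ⊗ Y j) ⊗ Z j) ≫
        (α_ (X j) (Y j) (Z j)).hom = (α_ (X j) (Y j) (Z j)).hom ≫ X j ◁ 𝟙 (Y j ⊗ Z j) ≫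
          𝟙 (X j ⊗ Y j ⊗ Z j) by simp
      left_unitality X := show (λ_ (X j)).hom = 𝟙 (𝟙_ (C j)) ▷ X j ≫ 𝟙 (𝟙_ (C j) ⊗ X j) ≫
        (λ_ (X j)).hom by simp
      right_unitality X := show (ρ_ (X j)).hom = X j ◁ 𝟙 (𝟙_ (C j)) ≫ 𝟙 (X j ⊗ 𝟙_ (C j)) ≫
        (ρ_ (X j)).hom by simp }
  braided X Y := (Category.id_comp (β_ (X j) (Y j)).hom).trans (Category.comp_id _).symm

/-- The product of a family of symmetric monoidal categories: the product category with the
pointwise symmetric monoidal structure. -/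
def prod (C : J → SymMonCat.{v, u}) : SymMonCat.{max w v, max w u} where
  carrier := ∀ j, C j

/-- The projections from the product; they are strict monoidal. -/
def proj (C : J → SymMonCat.{max w v, max w u}) (j : J) : prod C ⟶ C j :=
  StrongFunctor.mk (C := prod C) (D := C j) (Pi.eval (fun j => C j) j)
    (braided := piEvalBraided _ j)

end Product

/-! ## Coproducts -/

section StrictTensor

variable {C : Type u} [Category.{v} C] [MonoidalCategory C]

open Classical in
/-- The tensor product of two objects, with `𝟙_ ⊗ 𝟙_` replaced by `𝟙_`. -/
noncomputable def unitTensor (X Y : C) : C :=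
  if X = 𝟙_ C ∧ Y = 𝟙_ C then 𝟙_ C else X ⊗ Y

lemma unitTensor_unit {X Y : C} (hX : X = 𝟙_ C) (hY : Y = 𝟙_ C) : unitTensor X Y = 𝟙_ C :=
  if_pos ⟨hX, hY⟩

open Classical in
/-- The canonical isomorphism `X ⊗ Y ≅ unitTensor X Y`: the unitor if `X = Y = 𝟙_`, and the
identity otherwise. -/
noncomputable def unitTensorIso (X Y : C) : X ⊗ Y ≅ unitTensor X Y :=
  if h : X = 𝟙_ C ∧ Y = 𝟙_ C then
    (eqToIso h.1 ⊗ᵢ eqToIso h.2) ≪≫ λ_ (𝟙_ C) ≪≫ eqToIso (unitTensor_unit h.1 h.2).symm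
  else eqToIso (if_neg h).symm

/-- A morphism is a unit identity if it is the identity morphism of the monoidal unit. -/
def IsUnitId {X Y : C} (f : X ⟶ Y) : Prop :=
  ∃ (hX : X = 𝟙_ C) (hY : Y = 𝟙_ C), f = eqToHom (hX.trans hY.symm)

lemma isUnitId_id {X : C} (h : X = 𝟙_ C) : IsUnitId (𝟙 X) := ⟨h, h, rfl⟩

lemma IsUnitId.comp {X Y Z : C} {f : X ⟶ Y} {g : Y ⟶ Z} (hf : IsUnitId f) (hg : IsUnitId g) :
    IsUnitId (f ≫ g) := by
  obtain ⟨rfl, rfl, rfl⟩ := hf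
  obtain ⟨_, rfl, rfl⟩ := hg
  exact ⟨rfl, rfl, by simp⟩

lemma unitTensorIso_unit {X Y : C} (hX : X = 𝟙_ C) (hY : Y = 𝟙_ C) :
    (unitTensorIso X Y).hom = (eqToHom hX ⊗ₘ eqToHom hY) ≫ (λ_ (𝟙_ C)).hom ≫
      eqToHom (unitTensor_unit hX hY).symm := by
  simp [unitTensorIso, hX, hY]

lemma unitTensorIso_unit_inv {X Y : C} (hX : X = 𝟙_ C) (hY : Y = 𝟙_ C) :
    (unitTensorIso X Y).inv = eqToHom (unitTensor_unit hX hY) ≫ (λ_ (𝟙_ C)).inv ≫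
      (eqToHom hX.symm ⊗ₘ eqToHom hY.symm) := by
  simp [unitTensorIso, hX, hY]

lemma isUnitId_tensor {X X' Y Y' : C} {f : X ⟶ X'} {g : Y ⟶ Y'} (hf : IsUnitId f)
    (hg : IsUnitId g) :
    IsUnitId ((unitTensorIso X Y).inv ≫ (f ⊗ₘ g) ≫ (unitTensorIso X' Y').hom) := by
  obtain ⟨rfl, rfl, rfl⟩ := hf
  obtain ⟨rfl, rfl, rfl⟩ := hg
  exact ⟨unitTensor_unit rfl rfl, unitTensor_unit rfl rfl, by simp⟩

lemma isUnitId_whiskerRight {X X' Y : C} {f : X ⟶ X'} (hf : IsUnitId f) (hY : Y = 𝟙_ C) :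
    IsUnitId ((unitTensorIso X Y).inv ≫ (f ▷ Y) ≫ (unitTensorIso X' Y).hom) := by
  simpa using isUnitId_tensor hf (isUnitId_id hY)

lemma isUnitId_whiskerLeft {X Y Y' : C} {f : Y ⟶ Y'} (hX : X = 𝟙_ C) (hf : IsUnitId f) :
    IsUnitId ((unitTensorIso X Y).inv ≫ (X ◁ f) ≫ (unitTensorIso X Y').hom) := by
  simpa using isUnitId_tensor (isUnitId_id hX) hf

/-- The associator for `unitTensor`. -/
noncomputable def unitAssoc (X Y Z : C) :
    unitTensor (unitTensor X Y) Z ≅ unitTensor X (unitTensor Y Z) :=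
  ((unitTensorIso _ _).symm ≪≫ ((unitTensorIso _ _).symm ⊗ᵢ .refl _)) ≪≫ α_ X Y Z ≪≫
    ((.refl _ ⊗ᵢ unitTensorIso _ _) ≪≫ unitTensorIso _ _)

/-- The left unitor for `unitTensor`. -/
noncomputable def unitLeftUnitor (X : C) : unitTensor (𝟙_ C) X ≅ X :=
  (unitTensorIso _ _).symm ≪≫ λ_ X

/-- The right unitor for `unitTensor`. -/
noncomputable def unitRightUnitor (X : C) : unitTensor X (𝟙_ C) ≅ X :=
  (unitTensorIso _ _).symm ≪≫ ρ_ X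

/-- The braiding for `unitTensor`. -/
noncomputable def unitBraiding [BraidedCategory C] (X Y : C) : unitTensor X Y ≅ unitTensor Y X :=
  (unitTensorIso _ _).symm ≪≫ β_ X Y ≪≫ unitTensorIso _ _

lemma IsUnitId.inv {X Y : C} {f : X ≅ Y} (hf : IsUnitId f.hom) : IsUnitId f.inv := by
  obtain ⟨f, g, h, h'⟩ := f
  obtain ⟨rfl, rfl, rfl⟩ := hf
  exact ⟨rfl, rfl, by simpa using h⟩

lemma unitAssoc_aux {W V V' : C} (h : W = 𝟙_ C) (hV : V = 𝟙_ C) (hV' : V' = 𝟙_ C)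
    (a : 𝟙_ C ⊗ 𝟙_ C ≅ W) (b : W ⊗ 𝟙_ C ≅ V) (c : 𝟙_ C ⊗ W ≅ V')
    (ha : a.hom = (eqToHom rfl ⊗ₘ eqToHom rfl) ≫ (λ_ (𝟙_ C)).hom ≫ eqToHom h.symm)
    (hb : b.hom = (eqToHom h ⊗ₘ eqToHom rfl) ≫ (λ_ (𝟙_ C)).hom ≫ eqToHom hV.symm)
    (hc : c.hom = (eqToHom rfl ⊗ₘ eqToHom h) ≫ (λ_ (𝟙_ C)).hom ≫ eqToHom hV'.symm) :
    ((b.symm ≪≫ (a.symm ⊗ᵢ .refl _)) ≪≫ α_ (𝟙_ C) (𝟙_ C) (𝟙_ C) ≪≫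
      ((.refl _ ⊗ᵢ a) ≪≫ c)).hom = eqToHom (hV.trans hV'.symm) := by
  subst h hV hV'
  obtain rfl : a = λ_ (𝟙_ C) := by ext; simpa using ha
  obtain rfl : b = λ_ (𝟙_ C) := by ext; simpa using hb
  obtain rfl : c = λ_ (𝟙_ C) := by ext; simpa using hc
  have e : (λ_ (𝟙_ C)).hom ▷ 𝟙_ C = (α_ (𝟙_ C) (𝟙_ C) (𝟙_ C)).hom ≫ 𝟙_ C ◁ (λ_ (𝟙_ C)).hom := by
    rw [MonoidalCategory.triangle, unitors_equal]
  simp only [Iso.trans_hom, Iso.symm_hom, tensorIso_hom, Iso.refl_hom, Category.assoc,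
    tensorHom_id, id_tensorHom, eqToHom_refl]
  rw [← reassoc_of% e]
  simp

lemma isUnitId_assoc {X Y Z : C} (hX : X = 𝟙_ C) (hY : Y = 𝟙_ C) (hZ : Z = 𝟙_ C) :
    IsUnitId (unitAssoc X Y Z).hom := by
  refine ⟨unitTensor_unit (unitTensor_unit hX hY) hZ,
    unitTensor_unit hX (unitTensor_unit hY hZ), ?_⟩
  subst hX hY hZ
  have h := unitTensor_unit (C := C) rfl rfl
  exact unitAssoc_aux h (unitTensor_unit h rfl) (unitTensor_unit rfl h) _ _ _
    (unitTensorIso_unit rfl rfl) (unitTensorIso_unit h rfl)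
    (unitTensorIso_unit rfl h)

lemma isUnitId_leftUnitor {X : C} (hX : X = 𝟙_ C) : IsUnitId (unitLeftUnitor X).hom := by
  subst hX
  exact ⟨unitTensor_unit rfl rfl, rfl, by simp [unitLeftUnitor, unitTensorIso_unit_inv]⟩

lemma isUnitId_rightUnitor {X : C} (hX : X = 𝟙_ C) : IsUnitId (unitRightUnitor X).hom := by
  subst hX
  exact ⟨unitTensor_unit rfl rfl, rfl, by
    simp [unitRightUnitor, unitTensorIso_unit_inv, unitors_inv_equal]⟩

lemma isUnitId_braiding [BraidedCategory C] {X Y : C} (hX : X = 𝟙_ C) (hY : Y = 𝟙_ C) :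
    IsUnitId (unitBraiding X Y).hom := by
  subst hX hY
  exact ⟨unitTensor_unit rfl rfl, unitTensor_unit rfl rfl, by
    simp [unitBraiding, unitTensorIso_unit_inv, unitTensorIso_unit]
    rw [← unitors_equal]
    simp⟩

end StrictTensor

section Coproduct

variable {J : Type w}

open Filter

/-- The objects of the coproduct: families of objects `c j`, with `c j = 𝟙_` for all but finitely
many `j`. -/
structure CoprodObj (C : J → SymMonCat.{v, u}) : Type (max w u) where
  obj : ∀ j, C j
  finite : ∀ᶠ j in cofinite, obj j = 𝟙_ (C j)

namespace CoprodObj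

variable {C : J → SymMonCat.{v, u}}

/-- The morphisms of the coproduct: families of morphisms `f j : c j ⟶ d j`, with `f j` the
identity of `𝟙_` for all but finitely many `j`. -/
@[ext]
structure Hom (c d : CoprodObj C) : Type (max w v) where
  app : ∀ j, c.obj j ⟶ d.obj j
  finite : ∀ᶠ j in cofinite, IsUnitId (app j)

instance : Category (CoprodObj C) where
  Hom := Hom
  id c := ⟨fun j => 𝟙 (c.obj j), c.finite.mono fun _ => isUnitId_id⟩
  comp f g := ⟨fun j => f.app j ≫ g.app j, by
    filter_upwards [f.finite, g.finite] with j hf hg using hf.comp hg⟩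

@[ext]
lemma hom_ext {c d : CoprodObj C} {f g : c ⟶ d} (h : ∀ j, f.app j = g.app j) : f = g :=
  Hom.ext (funext h)

@[simp]
lemma id_app (c : CoprodObj C) (j : J) : Hom.app (𝟙 c) j = 𝟙 (c.obj j) := rfl

@[simp]
lemma comp_app {c d e : CoprodObj C} (f : c ⟶ d) (g : d ⟶ e) (j : J) :
    (f ≫ g).app j = f.app j ≫ g.app j := rfl

/-- A finitely supported family of isomorphisms is an isomorphism. -/
@[simps]
def mkIso {c d : CoprodObj C} (e : ∀ j, c.obj j ≅ d.obj j)
    (h : ∀ᶠ j in cofinite, IsUnitId (e j).hom) : c ≅ d where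
  hom := ⟨fun j => (e j).hom, h⟩
  inv := ⟨fun j => (e j).inv, h.mono fun _ => IsUnitId.inv⟩

/-- The pointwise tensor product, unit, associator and unitors, with `𝟙_ ⊗ 𝟙_` replaced
by `𝟙_`. -/
noncomputable instance : MonoidalCategoryStruct (CoprodObj C) where
  tensorObj c d := ⟨fun j => unitTensor (c.obj j) (d.obj j), by
    filter_upwards [c.finite, d.finite] with j using unitTensor_unit⟩
  whiskerLeft c _ _ f :=
    ⟨fun j => (unitTensorIso _ _).inv ≫ (c.obj j ◁ f.app j) ≫ (unitTensorIso _ _).hom, by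
      filter_upwards [c.finite, f.finite] with j using isUnitId_whiskerLeft⟩
  whiskerRight f d :=
    ⟨fun j => (unitTensorIso _ _).inv ≫ (f.app j ▷ d.obj j) ≫ (unitTensorIso _ _).hom, by
      filter_upwards [f.finite, d.finite] with j using isUnitId_whiskerRight⟩
  tensorHom f g :=
    ⟨fun j => (unitTensorIso _ _).inv ≫ (f.app j ⊗ₘ g.app j) ≫ (unitTensorIso _ _).hom, by
      filter_upwards [f.finite, g.finite] with j using isUnitId_tensor⟩
  tensorUnit := ⟨fun j => 𝟙_ (C j), Eventually.of_forall fun _ => rfl⟩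
  associator c d e := mkIso (fun j => unitAssoc (c.obj j) (d.obj j) (e.obj j)) (by
    filter_upwards [c.finite, d.finite, e.finite] with j using isUnitId_assoc)
  leftUnitor c := mkIso (fun j => unitLeftUnitor (c.obj j)) (by
    filter_upwards [c.finite] with j using isUnitId_leftUnitor)
  rightUnitor c := mkIso (fun j => unitRightUnitor (c.obj j)) (by
    filter_upwards [c.finite] with j using isUnitId_rightUnitor)

/-- The inclusion of the coproduct in the product. -/
@[simps]
def toPi (C : J → SymMonCat.{v, u}) : CoprodObj C ⥤ ∀ j, C j where
  obj c := c.obj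
  map f := f.app

instance : (toPi C).Faithful where
  map_injective h := hom_ext (congrFun h)

/-- The comparison of the tensor products of the coproduct and the product. -/
noncomputable def toPiData (C : J → SymMonCat.{v, u}) :
    Monoidal.InducingFunctorData (toPi C) where
  μIso c d := Pi.isoMk fun j => unitTensorIso (c.obj j) (d.obj j)
  εIso := Iso.refl _
  whiskerLeft_eq _ _ _ _ := rfl
  whiskerRight_eq _ _ := rfl
  tensorHom_eq _ _ := rfl
  associator_eq _ _ _ := rfl
  leftUnitor_eq c := by
    ext j
    change (unitTensorIso (𝟙_ (C j)) (c.obj j)).inv ≫ (λ_ (c.obj j)).hom =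
      ((unitTensorIso (𝟙_ (C j)) (c.obj j)).inv ≫ (𝟙 (𝟙_ (C j)) ⊗ₘ 𝟙 (c.obj j))) ≫
        (λ_ (c.obj j)).hom
    simp
  rightUnitor_eq c := by
    ext j
    change (unitTensorIso (c.obj j) (𝟙_ (C j))).inv ≫ (ρ_ (c.obj j)).hom =
      ((unitTensorIso (c.obj j) (𝟙_ (C j))).inv ≫ (𝟙 (c.obj j) ⊗ₘ 𝟙 (𝟙_ (C j)))) ≫
        (ρ_ (c.obj j)).hom
    simp

noncomputable instance : MonoidalCategory (CoprodObj C) :=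
  Monoidal.induced (toPi C) (toPiData C)

noncomputable instance : (toPi C).Monoidal :=
  Monoidal.fromInducedMonoidal (toPi C) (toPiData C)

/-- The pointwise braiding. -/
noncomputable instance : BraidedCategory (CoprodObj C) :=
  BraidedCategory.ofFaithful (toPi C)
    (fun c d => mkIso (fun j => unitBraiding (c.obj j) (d.obj j)) (by
      filter_upwards [c.finite, d.finite] with j using isUnitId_braiding)) (fun c d => by
      ext j
      exact Iso.hom_inv_id_assoc (unitTensorIso (c.obj j) (d.obj j))
        ((β_ (c.obj j) (d.obj j)).hom ≫ (unitTensorIso (d.obj j) (c.obj j)).hom))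

noncomputable instance : SymmetricCategory (CoprodObj C) where
  symmetry c d := by
    ext j
    change (unitBraiding (c.obj j) (d.obj j)).hom ≫ (unitBraiding (d.obj j) (c.obj j)).hom =
      𝟙 (unitTensor (c.obj j) (d.obj j))
    simp [unitBraiding]

end CoprodObj

/-- The coproduct of a family of symmetric monoidal categories: the symmetric monoidal category of
finitely supported families of objects. -/
noncomputable def coprod (C : J → SymMonCat.{v, u}) : SymMonCat.{max w v, max w u} where
  carrier := CoprodObj C

/-- The strong functor that is constant at the monoidal unit. -/
def unitFunctor (C D : SymMonCat.{v, u}) : StrongFunctor C D where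
  functor := (Functor.const C).obj (𝟙_ D)
  braided :=
    { toMonoidal := Functor.CoreMonoidal.toMonoidal
        { εIso := Iso.refl _
          μIso _ _ := λ_ (𝟙_ D)
          associativity _ _ _ := by
            simp only [Functor.const_obj_obj, Functor.const_obj_map, Category.comp_id]
            rw [MonoidalCategory.triangle_assoc, unitors_equal]
          right_unitality _ := by simp [unitors_equal] }
      braided _ _ := by
        change (λ_ (𝟙_ D)).hom ≫ 𝟙 (𝟙_ D) = (β_ (𝟙_ D) (𝟙_ D)).hom ≫ (λ_ (𝟙_ D)).hom
        rw [braiding_leftUnitor, Category.comp_id, unitors_equal] }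

lemma isUnitId_ε {C D : SymMonCat.{v, u}} {F : StrongFunctor C D} (hF : F = unitFunctor C D) :
    IsUnitId (Functor.LaxMonoidal.ε F.functor) := by
  subst hF
  exact ⟨rfl, rfl, rfl⟩

lemma isUnitId_μ {C D : SymMonCat.{v, u}} {F : StrongFunctor C D} (hF : F = unitFunctor C D)
    (X Y : C) :
    IsUnitId ((unitTensorIso _ _).inv ≫ Functor.LaxMonoidal.μ F.functor X Y) := by
  subst hF
  refine ⟨unitTensor_unit rfl rfl, rfl, ?_⟩
  change (unitTensorIso (𝟙_ D) (𝟙_ D)).inv ≫ (λ_ (𝟙_ D)).hom = _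
  simp [unitTensorIso_unit_inv]
  rfl

lemma isUnitId_map {C D : SymMonCat.{v, u}} {F : StrongFunctor C D} (hF : F = unitFunctor C D)
    {X Y : C} (f : X ⟶ Y) : IsUnitId (F.functor.map f) := by
  subst hF
  exact ⟨rfl, rfl, rfl⟩

open Functor.LaxMonoidal in
/-- A family of strong functors, all but finitely many of which are constant at the unit, induces a
strong functor to the coproduct. -/
noncomputable def toCoprod {C : J → SymMonCat.{max w v, max w u}} {A : SymMonCat.{max w v, max w u}}
    (F : ∀ j, StrongFunctor A (C j)) (hF : ∀ᶠ j in cofinite, F j = unitFunctor A (C j)) :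
    StrongFunctor A (coprod C) :=
  StrongFunctor.mk (C := A) (D := coprod C)
    { obj X := CoprodObj.mk (fun j => (F j).functor.obj X) (hF.mono fun _ h => by rw [h]; rfl)
      map f := CoprodObj.Hom.mk (fun j => (F j).functor.map f) (hF.mono fun _ h => isUnitId_map h f)
      map_id X := by apply CoprodObj.hom_ext; intro j; exact (F j).functor.map_id X
      map_comp f g := by apply CoprodObj.hom_ext; intro j; exact (F j).functor.map_comp f g }
    (braided :=
      { toMonoidal := Functor.CoreMonoidal.toMonoidal
          { εIso := CoprodObj.mkIso (fun j => Functor.Monoidal.εIso (F j).functor)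
              (hF.mono fun _ h => isUnitId_ε h)
            μIso X Y := CoprodObj.mkIso
              (fun j => (unitTensorIso _ _).symm ≪≫ Functor.Monoidal.μIso (F j).functor X Y)
              (hF.mono fun _ h => isUnitId_μ h X Y)
            μIso_hom_natural_left {X Y} f Z := by
              apply CoprodObj.hom_ext
              intro j
              let G := (F j).functor
              change ((unitTensorIso _ _).inv ≫ (G.map f ▷ G.obj Z) ≫ (unitTensorIso _ _).hom) ≫
                (unitTensorIso _ _).inv ≫ μ G Y Z =
                  ((unitTensorIso _ _).inv ≫ μ G X Z) ≫ G.map (f ▷ Z)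
              simp
            μIso_hom_natural_right {X Y} Z f := by
              apply CoprodObj.hom_ext
              intro j
              let G := (F j).functor
              change ((unitTensorIso _ _).inv ≫ (G.obj Z ◁ G.map f) ≫ (unitTensorIso _ _).hom) ≫
                (unitTensorIso _ _).inv ≫ μ G Z Y =
                  ((unitTensorIso _ _).inv ≫ μ G Z X) ≫ G.map (Z ◁ f)
              simp
            associativity X Y Z := by
              apply CoprodObj.hom_ext
              intro j
              let G := (F j).functor
              change ((unitTensorIso _ _).inv ≫ (((unitTensorIso _ _).inv ≫ μ G X Y) ▷ G.obj Z) ≫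
                  (unitTensorIso _ _).hom) ≫ ((unitTensorIso _ _).inv ≫ μ G (X ⊗ Y) Z) ≫
                    G.map (α_ X Y Z).hom =
                (unitAssoc (G.obj X) (G.obj Y) (G.obj Z)).hom ≫
                  ((unitTensorIso _ _).inv ≫ (G.obj X ◁ ((unitTensorIso _ _).inv ≫ μ G Y Z)) ≫
                    (unitTensorIso _ _).hom) ≫ ((unitTensorIso _ _).inv ≫ μ G X (Y ⊗ Z))
              simp [unitAssoc]
            left_unitality X := by
              apply CoprodObj.hom_ext
              intro j
              let G := (F j).functor
              change (unitLeftUnitor (G.obj X)).hom =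
                ((unitTensorIso _ _).inv ≫ (ε G ▷ G.obj X) ≫ (unitTensorIso _ _).hom) ≫
                  ((unitTensorIso _ _).inv ≫ μ G (𝟙_ A) X) ≫ G.map (λ_ X).hom
              simp [unitLeftUnitor]
            right_unitality X := by
              apply CoprodObj.hom_ext
              intro j
              let G := (F j).functor
              change (unitRightUnitor (G.obj X)).hom =
                ((unitTensorIso _ _).inv ≫ (G.obj X ◁ ε G) ≫ (unitTensorIso _ _).hom) ≫
                  ((unitTensorIso _ _).inv ≫ μ G X (𝟙_ A)) ≫ G.map (ρ_ X).hom
              simp [unitRightUnitor] }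
        braided X Y := by
          apply CoprodObj.hom_ext
          intro j
          let G := (F j).functor
          change ((unitTensorIso _ _).inv ≫ μ G X Y) ≫ G.map (β_ X Y).hom =
            (unitBraiding (G.obj X) (G.obj Y)).hom ≫ (unitTensorIso _ _).inv ≫ μ G Y X
          simp [unitBraiding] })

open Classical in
/-- The strong functor `C j ⥤ C k` that is the identity if `j = k` and constant at the unit
otherwise. -/
noncomputable def delta (C : J → SymMonCat.{v, u}) (j k : J) : StrongFunctor (C j) (C k) :=
  if h : j = k then h ▸ idFunctor (C j) else unitFunctor (C j) (C k)

lemma delta_of_ne (C : J → SymMonCat.{v, u}) {j k : J} (h : j ≠ k) :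
    delta C j k = unitFunctor (C j) (C k) := dif_neg h

lemma delta_self (C : J → SymMonCat.{v, u}) (j : J) : delta C j j = idFunctor (C j) :=
  dif_pos rfl

/-- The coprojections: `incl C j` sends `c` to the family with `c` at `j` and `𝟙_` elsewhere. -/
noncomputable def incl (C : J → SymMonCat.{max w v, max w u}) (j : J) : C j ⟶ coprod C :=
  toCoprod (delta C j) ((Set.finite_singleton j).subset fun _ hk =>
    by_contra fun h => hk (delta_of_ne C (Ne.symm h)))

end Coproduct

end SymMonCat

namespace SymMonCat

section StrictProduct

open Functor.LaxMonoidal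

variable {J : Type w} {C : J → SymMonCat.{max w v, max w u}} {A : SymMonCat.{max w v, max w u}}

/-- The strong functor to the product induced by a family of strong functors. -/
def pair (F : ∀ j, StrongFunctor A (C j)) : StrongFunctor A (prod C) :=
  StrongFunctor.mk (C := A) (D := prod C) (Functor.pi' fun j => (F j).functor)
    (braided :=
      { toMonoidal := Functor.CoreMonoidal.toMonoidal
          { εIso := Pi.isoMk fun j => Functor.Monoidal.εIso (F j).functor
            μIso X Y := Pi.isoMk fun j => Functor.Monoidal.μIso (F j).functor X Y
            μIso_hom_natural_left f Z := by
              apply Pi.ext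
              intro j
              exact μ_natural_left (F j).functor f Z
            μIso_hom_natural_right Z f := by
              apply Pi.ext
              intro j
              exact μ_natural_right (F j).functor Z f
            associativity X Y Z := by
              apply Pi.ext
              intro j
              exact associativity (F j).functor X Y Z
            left_unitality X := by
              apply Pi.ext
              intro j
              exact left_unitality (F j).functor X
            right_unitality X := by
              apply Pi.ext
              intro j
              exact right_unitality (F j).functor X }
        braided X Y := by
          apply Pi.ext
          intro j
          exact Functor.LaxBraided.braided (F := (F j).functor) X Y })

lemma compFunctor_pair (F : StrongFunctor A (prod C)) :
    pair (fun j => compFunctor F (proj C j)) = F :=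
  strongFunctor_ext (C := A) (D := prod C) (F := F.functor)
    (pair (fun j => compFunctor F (proj C j))).braided F.braided
    (funext fun j => Category.id_comp (ε F.functor j))
    (fun X Y => funext fun j => Category.id_comp (μ F.functor X Y j))

lemma pair_compFunctor (F : ∀ j, StrongFunctor A (C j)) (j : J) :
    compFunctor (pair F) (proj C j) = F j :=
  strongFunctor_ext (F := (F j).functor)
    (compFunctor (pair F) (proj C j)).braided (F j).braided
    (Category.id_comp (ε (F j).functor))
    (fun X Y => Category.id_comp (μ (F j).functor X Y))

/-- The monoidal transformation to the product induced by a family of monoidal transformations. -/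
def pairTrans {F G : ∀ j, StrongFunctor A (C j)} (α : ∀ j, F j ⟶ G j) : pair F ⟶ pair G :=
  MonoidalTrans.mk (F := pair F) (G := pair G)
    { app X := fun j => (α j).natTrans.app X
      naturality _ _ f := funext fun j => (α j).natTrans.naturality f }
    (isMonoidal :=
      { unit := funext fun j => NatTrans.IsMonoidal.unit (τ := (α j).natTrans)
        tensor X Y := funext fun j => NatTrans.IsMonoidal.tensor (τ := (α j).natTrans) X Y })

lemma eqToHom_pi_apply {ι : Type*} {D : ι → Type*} [∀ i, Category (D i)] {X Y : ∀ i, D i}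
    (h : X = Y) (i : ι) : eqToHom h i = eqToHom (congrFun h i) := by
  subst h
  rfl

theorem isStrictTwoProduct_proj (C : J → SymMonCat.{max w v, max w u}) :
    IsStrictTwoProduct (proj C) := by
  intro A
  refine ⟨{ obj := pair, map := pairTrans, map_id := fun _ => rfl, map_comp := fun _ _ => rfl },
    ?_, ?_⟩
  · refine CategoryTheory.Functor.ext (fun F => compFunctor_pair F) fun F G α => ?_
    apply trans_ext
    intro X
    erw [NatTrans.comp_app, NatTrans.comp_app, eqToHom_natTrans_app, eqToHom_natTrans_app]
    exact ((Category.id_comp _).trans (Category.comp_id _)).symm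
  · refine CategoryTheory.Functor.ext (fun F => funext fun j => pair_compFunctor F j)
      fun F G α => ?_
    funext j
    apply trans_ext
    intro X
    erw [Pi.comp_apply, Pi.comp_apply, eqToHom_pi_apply, eqToHom_pi_apply, NatTrans.comp_app,
      NatTrans.comp_app, eqToHom_natTrans_app, eqToHom_natTrans_app]
    exact ((Category.id_comp _).trans (Category.comp_id _)).symm

end StrictProduct

section Tensor

variable {D : Type*} [Category* D] [MonoidalCategory D]

lemma tensorμ_braiding [SymmetricCategory D] (W X Y Z : D) :
    tensorμ W X Y Z ≫ ((β_ W Y).hom ⊗ₘ (β_ X Z).hom) =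
      (β_ (W ⊗ X) (Y ⊗ Z)).hom ≫ tensorμ Y Z W X := by
  have h : Y ◁ (β_ W Z).hom ▷ X ≫ Y ◁ (β_ Z W).hom ▷ X = 𝟙 _ := by
    rw [← MonoidalCategory.whiskerLeft_comp, ← comp_whiskerRight, SymmetricCategory.symmetry]
    simp
  simp [tensorμ, MonoidalCategory.tensorHom_def, reassoc_of% h]

end Tensor
end SymMonCat

namespace SymMonCat

section TensorFunctor

open Functor.LaxMonoidal Functor.OplaxMonoidal

variable {A B D : SymMonCat.{v, u}}

@[simp]
lemma compFunctor_obj (F : StrongFunctor A B) (G : StrongFunctor B D) (X : A) :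
    (compFunctor F G).functor.obj X = G.functor.obj (F.functor.obj X) := rfl

@[simp]
lemma compFunctor_map (F : StrongFunctor A B) (G : StrongFunctor B D) {X Y : A} (f : X ⟶ Y) :
    (compFunctor F G).functor.map f = G.functor.map (F.functor.map f) := rfl

@[simp]
lemma compFunctor_ε (F : StrongFunctor A B) (G : StrongFunctor B D) :
    ε (compFunctor F G).functor = ε G.functor ≫ G.functor.map (ε F.functor) := rfl

@[simp]
lemma compFunctor_μ (F : StrongFunctor A B) (G : StrongFunctor B D) (X Y : A) :
    μ (compFunctor F G).functor X Y =
      μ G.functor (F.functor.obj X) (F.functor.obj Y) ≫ G.functor.map (μ F.functor X Y) := rfl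

@[simp]
lemma idFunctor_obj (X : A) : (idFunctor A).functor.obj X = X := rfl

@[simp]
lemma idFunctor_map {X Y : A} (f : X ⟶ Y) : (idFunctor A).functor.map f = f := rfl

@[simp]
lemma idFunctor_ε : ε (idFunctor A).functor = 𝟙 (𝟙_ A) := rfl

@[simp]
lemma idFunctor_μ (X Y : A) : μ (idFunctor A).functor X Y = 𝟙 (X ⊗ Y) := rfl

@[simp]
lemma unitFunctor_obj (X : A) : (unitFunctor A B).functor.obj X = 𝟙_ B := rfl

@[simp]
lemma unitFunctor_map {X Y : A} (f : X ⟶ Y) : (unitFunctor A B).functor.map f = 𝟙 (𝟙_ B) := rfl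

@[simp]
lemma unitFunctor_ε : ε (unitFunctor A B).functor = 𝟙 (𝟙_ B) := rfl

@[simp]
lemma unitFunctor_μ (X Y : A) : μ (unitFunctor A B).functor X Y = (λ_ (𝟙_ B)).hom := rfl

/-- A strong monoidal isomorphism from its components. -/
def isoOfComponents {F G : StrongFunctor A B} (e : ∀ X, F.functor.obj X ≅ G.functor.obj X)
    (naturality : ∀ {X Y : A} (f : X ⟶ Y),
      F.functor.map f ≫ (e Y).hom = (e X).hom ≫ G.functor.map f)
    (unit : ε F.functor ≫ (e (𝟙_ A)).hom = ε G.functor)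
    (tensor : ∀ X Y, μ F.functor X Y ≫ (e (X ⊗ Y)).hom =
      ((e X).hom ⊗ₘ (e Y).hom) ≫ μ G.functor X Y) : F ≅ G :=
  mkIso (NatIso.ofComponents e naturality) (m := ⟨unit, tensor⟩)

@[simp]
lemma isoOfComponents_hom_app {F G : StrongFunctor A B}
    (e : ∀ X, F.functor.obj X ≅ G.functor.obj X) (h₁ h₂ h₃) (X : A) :
    (isoOfComponents (F := F) (G := G) e h₁ h₂ h₃).hom.natTrans.app X = (e X).hom := rfl

@[simp]
lemma isoOfComponents_inv_app {F G : StrongFunctor A B}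
    (e : ∀ X, F.functor.obj X ≅ G.functor.obj X) (h₁ h₂ h₃) (X : A) :
    (isoOfComponents (F := F) (G := G) e h₁ h₂ h₃).inv.natTrans.app X = (e X).inv := rfl

/-- The components of an isomorphism of strong functors. -/
@[simps]
def appIso {F G : StrongFunctor A B} (e : F ≅ G) (X : A) :
    F.functor.obj X ≅ G.functor.obj X where
  hom := e.hom.natTrans.app X
  inv := e.inv.natTrans.app X
  hom_inv_id := by rw [← NatTrans.comp_app, ← comp_natTrans, e.hom_inv_id]; rfl
  inv_hom_id := by rw [← NatTrans.comp_app, ← comp_natTrans, e.inv_hom_id]; rfl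

/-- The pointwise tensor product of two strong functors. -/
def tensorFunctor (F G : StrongFunctor A B) : StrongFunctor A B where
  functor :=
    { obj X := F.functor.obj X ⊗ G.functor.obj X
      map f := F.functor.map f ⊗ₘ G.functor.map f }
  braided :=
    { toMonoidal := Functor.CoreMonoidal.toMonoidal
        { εIso := (λ_ (𝟙_ B)).symm ≪≫
            (Functor.Monoidal.εIso F.functor ⊗ᵢ Functor.Monoidal.εIso G.functor)
          μIso X Y :=
            { hom := tensorμ _ _ _ _
              inv := tensorδ _ _ _ _ } ≪≫
            (Functor.Monoidal.μIso F.functor X Y ⊗ᵢ Functor.Monoidal.μIso G.functor X Y)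
          μIso_hom_natural_left {X Y} f Z := by
            change (F.functor.map f ⊗ₘ G.functor.map f) ▷ (F.functor.obj Z ⊗ G.functor.obj Z) ≫
              tensorμ _ _ _ _ ≫ (μ F.functor Y Z ⊗ₘ μ G.functor Y Z) =
              (tensorμ _ _ _ _ ≫ (μ F.functor X Z ⊗ₘ μ G.functor X Z)) ≫
                (F.functor.map (f ▷ Z) ⊗ₘ G.functor.map (f ▷ Z))
            rw [reassoc_of% tensorμ_natural_left]
            simp
          μIso_hom_natural_right {X Y} Z f := by
            change (F.functor.obj Z ⊗ G.functor.obj Z) ◁ (F.functor.map f ⊗ₘ G.functor.map f) ≫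
              tensorμ _ _ _ _ ≫ (μ F.functor Z Y ⊗ₘ μ G.functor Z Y) =
              (tensorμ _ _ _ _ ≫ (μ F.functor Z X ⊗ₘ μ G.functor Z X)) ≫
                (F.functor.map (Z ◁ f) ⊗ₘ G.functor.map (Z ◁ f))
            rw [reassoc_of% tensorμ_natural_right]
            simp
          associativity X Y Z := by
            change (tensorμ _ _ _ _ ≫ (μ F.functor X Y ⊗ₘ μ G.functor X Y)) ▷
                (F.functor.obj Z ⊗ G.functor.obj Z) ≫
                (tensorμ _ _ _ _ ≫ (μ F.functor (X ⊗ Y) Z ⊗ₘ μ G.functor (X ⊗ Y) Z)) ≫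
                  (F.functor.map (α_ X Y Z).hom ⊗ₘ G.functor.map (α_ X Y Z).hom) =
              (α_ (F.functor.obj X ⊗ G.functor.obj X) (F.functor.obj Y ⊗ G.functor.obj Y)
                (F.functor.obj Z ⊗ G.functor.obj Z)).hom ≫ (F.functor.obj X ⊗ G.functor.obj X) ◁
                  (tensorμ _ _ _ _ ≫ (μ F.functor Y Z ⊗ₘ μ G.functor Y Z)) ≫
                (tensorμ _ _ _ _ ≫ (μ F.functor X (Y ⊗ Z) ⊗ₘ μ G.functor X (Y ⊗ Z)))
            simp only [comp_whiskerRight, MonoidalCategory.whiskerLeft_comp, Category.assoc,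
              reassoc_of% tensorμ_natural_left, reassoc_of% tensorμ_natural_right,
              ← reassoc_of% tensor_associativity, tensorHom_comp_tensorHom,
              Functor.LaxMonoidal.associativity]
          left_unitality X := by
            change (λ_ (F.functor.obj X ⊗ G.functor.obj X)).hom =
              ((λ_ (𝟙_ B)).inv ≫ (ε F.functor ⊗ₘ ε G.functor)) ▷
                (F.functor.obj X ⊗ G.functor.obj X) ≫
                (tensorμ _ _ _ _ ≫ (μ F.functor (𝟙_ A) X ⊗ₘ μ G.functor (𝟙_ A) X)) ≫
                  (F.functor.map (λ_ X).hom ⊗ₘ G.functor.map (λ_ X).hom)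
            simp only [comp_whiskerRight, Category.assoc, reassoc_of% tensorμ_natural_left,
              tensorHom_comp_tensorHom, ← Functor.LaxMonoidal.left_unitality,
              ← tensor_left_unitality]
          right_unitality X := by
            change (ρ_ (F.functor.obj X ⊗ G.functor.obj X)).hom =
              (F.functor.obj X ⊗ G.functor.obj X) ◁
                ((λ_ (𝟙_ B)).inv ≫ (ε F.functor ⊗ₘ ε G.functor)) ≫
                (tensorμ _ _ _ _ ≫ (μ F.functor X (𝟙_ A) ⊗ₘ μ G.functor X (𝟙_ A))) ≫
                  (F.functor.map (ρ_ X).hom ⊗ₘ G.functor.map (ρ_ X).hom)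
            simp only [MonoidalCategory.whiskerLeft_comp, Category.assoc,
              reassoc_of% tensorμ_natural_right,
              tensorHom_comp_tensorHom, ← Functor.LaxMonoidal.right_unitality,
              ← tensor_right_unitality] }
      braided X Y := by
        change (tensorμ _ _ _ _ ≫ (μ F.functor X Y ⊗ₘ μ G.functor X Y)) ≫
          (F.functor.map (β_ X Y).hom ⊗ₘ G.functor.map (β_ X Y).hom) =
          (β_ (F.functor.obj X ⊗ G.functor.obj X) (F.functor.obj Y ⊗ G.functor.obj Y)).hom ≫
            tensorμ _ _ _ _ ≫ (μ F.functor Y X ⊗ₘ μ G.functor Y X)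
        rw [← reassoc_of% tensorμ_braiding]
        simp }

@[simp]
lemma tensorFunctor_obj (F G : StrongFunctor A B) (X : A) :
    (tensorFunctor F G).functor.obj X = F.functor.obj X ⊗ G.functor.obj X := rfl

@[simp]
lemma tensorFunctor_map (F G : StrongFunctor A B) {X Y : A} (f : X ⟶ Y) :
    (tensorFunctor F G).functor.map f = F.functor.map f ⊗ₘ G.functor.map f := rfl

@[simp]
lemma tensorFunctor_ε (F G : StrongFunctor A B) :
    ε (tensorFunctor F G).functor = (λ_ (𝟙_ B)).inv ≫ (ε F.functor ⊗ₘ ε G.functor) := rfl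

@[simp]
lemma tensorFunctor_μ (F G : StrongFunctor A B) (X Y : A) :
    μ (tensorFunctor F G).functor X Y =
      tensorμ _ _ _ _ ≫ (μ F.functor X Y ⊗ₘ μ G.functor X Y) := rfl

/-- The tensor product of monoidal isomorphisms. -/
def tensorFunctorIso {F F' G G' : StrongFunctor A B} (e : F ≅ F') (e' : G ≅ G') :
    tensorFunctor F G ≅ tensorFunctor F' G' :=
  isoOfComponents (fun X => appIso e X ⊗ᵢ appIso e' X) (by simp) (by simp)
    (fun X Y => by
      have h₁ := NatTrans.IsMonoidal.tensor (τ := e.hom.natTrans) X Y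
      have h₂ := NatTrans.IsMonoidal.tensor (τ := e'.hom.natTrans) X Y
      simp only [tensorFunctor_μ, tensorIso_hom, appIso_hom, Category.assoc, tensorFunctor_obj,
        tensorHom_comp_tensorHom, h₁, h₂, reassoc_of% tensorμ_natural])

/-- Tensor products of strong functors are computed after precomposition. -/
def compTensorIso (H : StrongFunctor D A) (F G : StrongFunctor A B) :
    compFunctor H (tensorFunctor F G) ≅ tensorFunctor (compFunctor H F) (compFunctor H G) :=
  isoOfComponents (fun _ => Iso.refl _) (by simp) (by simp) (by simp)

/-- Strong functors preserve tensor products of strong functors. -/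
def tensorCompIso (F G : StrongFunctor A B) (H : StrongFunctor B D) :
    compFunctor (tensorFunctor F G) H ≅ tensorFunctor (compFunctor F H) (compFunctor G H) :=
  isoOfComponents
    (fun X => (Functor.Monoidal.μIso H.functor (F.functor.obj X) (G.functor.obj X)).symm)
    (by simp)
    (by
      change (ε H.functor ≫ H.functor.map ((λ_ (𝟙_ B)).inv ≫ (ε F.functor ⊗ₘ ε G.functor))) ≫
        δ H.functor _ _ = (λ_ (𝟙_ D)).inv ≫
          ((ε H.functor ≫ H.functor.map (ε F.functor)) ⊗ₘ
            (ε H.functor ≫ H.functor.map (ε G.functor)))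
      rw [← cancel_mono (μ H.functor (F.functor.obj (𝟙_ A)) (G.functor.obj (𝟙_ A)))]
      have h : ε H.functor ≫ H.functor.map (λ_ (𝟙_ B)).inv =
          (λ_ (𝟙_ D)).inv ≫ (ε H.functor ⊗ₘ ε H.functor) ≫ μ H.functor (𝟙_ B) (𝟙_ B) := by
        rw [← Functor.LaxMonoidal.left_unitality_inv, MonoidalCategory.tensorHom_def',
          Category.assoc, leftUnitor_inv_naturality_assoc]
      simp [← tensorHom_comp_tensorHom, reassoc_of% h])
    (fun X Y => by
      have h := tensorμ_comp_μ_tensorHom_μ_comp_μ H.functor (F.functor.obj X) (G.functor.obj X)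
        (F.functor.obj Y) (G.functor.obj Y)
      change (μ H.functor _ _ ≫ H.functor.map (tensorμ _ _ _ _ ≫
          (μ F.functor X Y ⊗ₘ μ G.functor X Y))) ≫ δ H.functor _ _ =
        (δ H.functor _ _ ⊗ₘ δ H.functor _ _) ≫ tensorμ _ _ _ _ ≫
          ((μ H.functor _ _ ≫ H.functor.map (μ F.functor X Y)) ⊗ₘ
            (μ H.functor _ _ ≫ H.functor.map (μ G.functor X Y)))
      rw [← cancel_mono (μ H.functor (F.functor.obj (X ⊗ Y)) (G.functor.obj (X ⊗ Y))),
        ← cancel_epi (μ H.functor (F.functor.obj X) (G.functor.obj X) ⊗ₘ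
          μ H.functor (F.functor.obj Y) (G.functor.obj Y))]
      simp at h ⊢
      rw [← reassoc_of% h]
      simp [← tensorHom_comp_tensorHom])

/-- The unit functor is a left unit for the tensor product. -/
def unitTensorFunctorIso (F : StrongFunctor A B) : tensorFunctor (unitFunctor A B) F ≅ F :=
  isoOfComponents (fun X => λ_ (F.functor.obj X)) (by simp) (by simp)
    (fun X Y => by
      have h := leftUnitor_monoidal (F.functor.obj X) (F.functor.obj Y)
      change (tensorμ _ _ _ _ ≫ ((λ_ (𝟙_ B)).hom ⊗ₘ μ F.functor X Y)) ≫ (λ_ _).hom =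
        ((λ_ _).hom ⊗ₘ (λ_ _).hom) ≫ μ F.functor X Y
      simp only [h, MonoidalCategory.tensorHom_def (λ_ (𝟙_ B)).hom, Category.assoc,
        leftUnitor_naturality])

/-- The unit functor is a right unit for the tensor product. -/
def tensorUnitFunctorIso (F : StrongFunctor A B) : tensorFunctor F (unitFunctor A B) ≅ F :=
  isoOfComponents (fun X => ρ_ (F.functor.obj X)) (by simp)
    (by
      change ((λ_ (𝟙_ B)).inv ≫ (ε F.functor ⊗ₘ 𝟙 (𝟙_ B))) ≫ (ρ_ _).hom = ε F.functor
      rw [tensorHom_id, Category.assoc, rightUnitor_naturality, ← unitors_equal,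
        Iso.inv_hom_id_assoc])
    (fun X Y => by
      have h := rightUnitor_monoidal (F.functor.obj X) (F.functor.obj Y)
      change (tensorμ _ _ _ _ ≫ (μ F.functor X Y ⊗ₘ (λ_ (𝟙_ B)).hom)) ≫ (ρ_ _).hom =
        ((ρ_ _).hom ⊗ₘ (ρ_ _).hom) ≫ μ F.functor X Y
      simp only [h, MonoidalCategory.tensorHom_def' _ (λ_ (𝟙_ B)).hom, Category.assoc,
        rightUnitor_naturality])

/-- Composing the unit functor with a strong functor. -/
def unitCompIso (H : StrongFunctor B D) : compFunctor (unitFunctor A B) H ≅ unitFunctor A D :=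
  isoOfComponents (fun _ => (Functor.Monoidal.εIso H.functor).symm) (by simp) (by simp)
    (by simp [MonoidalCategory.tensorHom_def])

/-- Precomposition of a monoidal isomorphism with a strong functor. -/
def compIsoLeft (F : StrongFunctor A B) {G H : StrongFunctor B D} (e : G ≅ H) :
    compFunctor F G ≅ compFunctor F H :=
  isoOfComponents (fun X => appIso e (F.functor.obj X)) (by simp) (by simp)
    (by simp)

/-- Postcomposition of a monoidal isomorphism with a strong functor. -/
def compIsoRight {F G : StrongFunctor A B} (e : F ≅ G) (H : StrongFunctor B D) :
    compFunctor F H ≅ compFunctor G H :=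
  isoOfComponents (fun X => H.functor.mapIso (appIso e X)) (by simp [← Functor.map_comp])
    (by simp [← Functor.map_comp]) (by simp [← Functor.map_comp])

/-- Associativity of composition. -/
def compAssocIso {E : SymMonCat.{v, u}} (F : StrongFunctor A B) (G : StrongFunctor B D)
    (H : StrongFunctor D E) :
    compFunctor (compFunctor F G) H ≅ compFunctor F (compFunctor G H) :=
  isoOfComponents (fun _ => Iso.refl _) (by simp) (by simp) (by simp)

/-- The identity is a left unit for composition. -/
def idCompIso (F : StrongFunctor A B) : compFunctor (idFunctor A) F ≅ F :=
  isoOfComponents (fun _ => Iso.refl _) (by simp) (by simp) (by simp)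

end TensorFunctor
end SymMonCat

namespace SymMonCat

open Functor.LaxMonoidal Functor.OplaxMonoidal

section Combine

variable {A B : SymMonCat.{v, u}} {F G : StrongFunctor A B}

/-- The canonical morphism between the values at the unit of two strong functors. -/
def unitHom (F G : StrongFunctor A B) : F.functor.obj (𝟙_ A) ⟶ G.functor.obj (𝟙_ A) :=
  η F.functor ≫ ε G.functor

/-- The morphism `F (X ⊗ Y) ⟶ G (X ⊗ Y)` assembled from its restrictions to `X` and `Y`. -/
def combine {X Y : A} (β : F.functor.obj X ⟶ G.functor.obj X)
    (γ : F.functor.obj Y ⟶ G.functor.obj Y) : F.functor.obj (X ⊗ Y) ⟶ G.functor.obj (X ⊗ Y) :=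
  δ F.functor X Y ≫ (β ⊗ₘ γ) ≫ μ G.functor X Y

lemma combine_naturality {X Y X' Y' : A} (f : X ⟶ X') (g : Y ⟶ Y')
    {β : F.functor.obj X ⟶ G.functor.obj X} {γ : F.functor.obj Y ⟶ G.functor.obj Y}
    {β' : F.functor.obj X' ⟶ G.functor.obj X'} {γ' : F.functor.obj Y' ⟶ G.functor.obj Y'}
    (hf : F.functor.map f ≫ β' = β ≫ G.functor.map f)
    (hg : F.functor.map g ≫ γ' = γ ≫ G.functor.map g) :
    F.functor.map (f ⊗ₘ g) ≫ combine β' γ' = combine β γ ≫ G.functor.map (f ⊗ₘ g) := by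
  simp only [combine, Category.assoc, ← μ_natural, tensorHom_comp_tensorHom_assoc, ← hf, ← hg]
  rw [← tensorHom_comp_tensorHom, Category.assoc, ← δ_natural_assoc]

lemma map_rightUnitor_inv_combine {X : A} (β : F.functor.obj X ⟶ G.functor.obj X) :
    F.functor.map (ρ_ X).inv ≫ combine β (unitHom F G) = β ≫ G.functor.map (ρ_ X).inv := by
  have h : F.functor.map (ρ_ X).inv ≫ δ F.functor X (𝟙_ A) ≫ F.functor.obj X ◁ η F.functor =
      (ρ_ (F.functor.obj X)).inv := by simp
  rw [← right_unitality_inv G.functor, rightUnitor_inv_naturality_assoc, ← h]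
  have h' : (β ⊗ₘ (η F.functor ≫ ε G.functor)) =
      _ ◁ η F.functor ≫ β ▷ _ ≫ _ ◁ ε G.functor := by
    rw [MonoidalCategory.tensorHom_def', MonoidalCategory.whiskerLeft_comp, Category.assoc,
      whisker_exchange]
  simp only [combine, unitHom, h', Category.assoc]

lemma map_leftUnitor_inv_combine {X : A} (β : F.functor.obj X ⟶ G.functor.obj X) :
    F.functor.map (λ_ X).inv ≫ combine (unitHom F G) β = β ≫ G.functor.map (λ_ X).inv := by
  have h : F.functor.map (λ_ X).inv ≫ δ F.functor (𝟙_ A) X ≫ η F.functor ▷ F.functor.obj X =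
      (λ_ (F.functor.obj X)).inv := by simp
  rw [← left_unitality_inv G.functor, leftUnitor_inv_naturality_assoc, ← h]
  have h' : ((η F.functor ≫ ε G.functor) ⊗ₘ β) =
      η F.functor ▷ _ ≫ _ ◁ β ≫ ε G.functor ▷ _ := by
    rw [MonoidalCategory.tensorHom_def, comp_whiskerRight, Category.assoc, ← whisker_exchange]
  simp only [combine, unitHom, h', Category.assoc]

lemma map_η_unitHom {E : SymMonCat.{v, u}} {H : StrongFunctor E A}
    (w : F.functor.obj (H.functor.obj (𝟙_ E)) ⟶ G.functor.obj (H.functor.obj (𝟙_ E)))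
    (h : (ε F.functor ≫ F.functor.map (ε H.functor)) ≫ w =
      ε G.functor ≫ G.functor.map (ε H.functor)) :
    F.functor.map (η H.functor) ≫ unitHom F G = w ≫ G.functor.map (η H.functor) := by
  have h' := h =≫ G.functor.map (η H.functor)
  rw [Category.assoc, Category.assoc] at h'
  rw [← cancel_epi (F.functor.map (ε H.functor)), ← cancel_epi (ε F.functor), h']
  simp [unitHom, ← Functor.map_comp, ← Functor.map_comp_assoc]

lemma map_comp_naturality {X Y Z : A} {f : X ⟶ Y} {g : Y ⟶ Z}
    {β : F.functor.obj X ⟶ G.functor.obj X} {γ : F.functor.obj Y ⟶ G.functor.obj Y}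
    {φ : F.functor.obj Z ⟶ G.functor.obj Z}
    (hf : F.functor.map f ≫ γ = β ≫ G.functor.map f)
    (hg : F.functor.map g ≫ φ = γ ≫ G.functor.map g) :
    F.functor.map (f ≫ g) ≫ φ = β ≫ G.functor.map (f ≫ g) := by
  rw [Functor.map_comp, Functor.map_comp, Category.assoc, hg, reassoc_of% hf]

end Combine

variable {J : Type w} [DecidableEq J]

/-- A decomposition of a symmetric monoidal category `S` into a family of symmetric monoidal
categories `C j`: coprojections, projections, and functors `erase k` that replace the component
at `k` by the unit, so that every object is canonically the tensor product of its component at `k`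
and the remaining components. Every morphism is supported at a finite set of indices. -/
structure Decomposition (C : J → SymMonCat.{v, u}) (S : SymMonCat.{v, u}) where
  incl (j : J) : StrongFunctor (C j) S
  proj (j : J) : StrongFunctor S (C j)
  erase (k : J) : StrongFunctor S S
  supp (s : Finset J) : MorphismProperty S
  supp_comp {s : Finset J} {X Y Z : S} {f : X ⟶ Y} {g : Y ⟶ Z} :
    supp s f → supp s g → supp s (f ≫ g)
  supp_source {s : Finset J} {X Y : S} {f : X ⟶ Y} : supp s f → supp s (𝟙 X)
  supp_target {s : Finset J} {X Y : S} {f : X ⟶ Y} : supp s f → supp s (𝟙 Y)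
  supp_mono {s t : Finset J} (h : s ⊆ t) {X Y : S} {f : X ⟶ Y} : supp s f → supp t f
  supp_inter {s t : Finset J} {X Y : S} {f : X ⟶ Y} : supp s f → supp t f → supp (s ∩ t) f
  exists_supp {X Y : S} (f : X ⟶ Y) : ∃ s, supp s f
  supp_tensorHom {s : Finset J} {X Y X' Y' : S} {f : X ⟶ X'} {g : Y ⟶ Y'} :
    supp s f → supp s g → supp s (f ⊗ₘ g)
  supp_leftUnitor : supp ∅ (λ_ (𝟙_ S)).hom
  supp_incl (j : J) {X Y : C j} (f : X ⟶ Y) : supp {j} ((incl j).functor.map f)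
  supp_erase {k : J} {s : Finset J} {X Y : S} {f : X ⟶ Y} :
    supp (insert k s) f → supp s ((erase k).functor.map f)
  supp_erase_ε (k : J) (s : Finset J) : supp s (ε (erase k).functor)
  supp_erase_μ {k : J} {s : Finset J} {X Y : S} :
    supp (insert k s) (𝟙 X) → supp (insert k s) (𝟙 Y) → supp s (μ (erase k).functor X Y)
  eq_of_supp_empty {X Y : S} {f g : X ⟶ Y} : supp ∅ f → supp ∅ g → f = g
  exists_unitIso {X : S} : supp ∅ (𝟙 X) → ∃ e : X ≅ 𝟙_ S, supp ∅ e.hom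
  split (k : J) : idFunctor S ≅ tensorFunctor (compFunctor (proj k) (incl k)) (erase k)
  supp_split {k : J} {s : Finset J} (hk : k ∈ s) {X : S} :
    supp s (𝟙 X) → supp s ((split k).hom.natTrans.app X)
  inclProj (k : J) : compFunctor (incl k) (proj k) ≅ idFunctor (C k)
  inclProjNe {j k : J} (h : j ≠ k) : compFunctor (incl j) (proj k) ≅ unitFunctor (C j) (C k)
  inclErase (k : J) : compFunctor (incl k) (erase k) ≅ unitFunctor (C k) S
  inclEraseNe {j k : J} (h : j ≠ k) : compFunctor (incl j) (erase k) ≅ incl j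
  supp_inclErase (k : J) (x : C k) : supp ∅ ((inclErase k).hom.natTrans.app x)
  supp_inclEraseNe {j k : J} (h : j ≠ k) (x : C j) : supp {j} ((inclEraseNe h).hom.natTrans.app x)
  split_incl (k : J) (x : C k) :
    (split k).hom.natTrans.app ((incl k).functor.obj x) ≫
      ((incl k).functor.map ((inclProj k).hom.natTrans.app x) ⊗ₘ
        (inclErase k).hom.natTrans.app x) = (ρ_ ((incl k).functor.obj x)).inv
  split_incl_ne {j k : J} (h : j ≠ k) (x : C j) :
    (split k).hom.natTrans.app ((incl j).functor.obj x) ≫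
      (((incl k).functor.map ((inclProjNe h).hom.natTrans.app x) ≫ η (incl k).functor) ⊗ₘ
        (inclEraseNe h).hom.natTrans.app x) = (λ_ ((incl j).functor.obj x)).inv

lemma eq_of_comp_eq_id {A : Type*} [Category* A] {P Q : A} {f g : P ⟶ Q} {h : Q ⟶ P}
    (hf : f ≫ h = 𝟙 P) (hg : h ≫ g = 𝟙 Q) : f = g :=
  by rw [← Category.comp_id f, ← hg, ← Category.assoc, hf, Category.id_comp]

lemma cancel_split {A B : SymMonCat.{v, u}} {F G : StrongFunctor A B} {c d d' : A} (σ : c ≅ d)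
    (τ : d ≅ d') {ρ : c ⟶ d'} (h : σ.hom ≫ τ.hom = ρ)
    {m n : F.functor.obj c ⟶ G.functor.obj c} {p : F.functor.obj d ⟶ G.functor.obj d}
    {q : F.functor.obj d' ⟶ G.functor.obj d'}
    (h₁ : m ≫ G.functor.map σ.hom = F.functor.map σ.hom ≫ p)
    (h₂ : F.functor.map τ.hom ≫ q = p ≫ G.functor.map τ.hom)
    (h₃ : F.functor.map ρ ≫ q = n ≫ G.functor.map ρ) : m = n := by
  subst h
  rw [← cancel_mono (G.functor.map (σ.hom ≫ τ.hom)), ← h₃, Functor.map_comp, reassoc_of% h₁,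
    ← h₂, Functor.map_comp, Category.assoc]

namespace Decomposition

variable {C : J → SymMonCat.{v, u}} {S : SymMonCat.{v, u}} (D : Decomposition C S)
  {X : SymMonCat.{v, u}}

lemma supp_unit (s : Finset J) : D.supp s (𝟙 (𝟙_ S)) :=
  D.supp_mono (Finset.empty_subset s) (D.supp_target D.supp_leftUnitor)

lemma supp_tensor {s : Finset J} {c d : S} (hc : D.supp s (𝟙 c)) (hd : D.supp s (𝟙 d)) :
    D.supp s (𝟙 (c ⊗ d)) := by
  simpa using D.supp_tensorHom hc hd

/-- The decomposition of an object into its component at `k` and the remaining components. -/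
def splitIso (k : J) (c : S) :
    c ≅ (D.incl k).functor.obj ((D.proj k).functor.obj c) ⊗ (D.erase k).functor.obj c :=
  appIso (D.split k) c

/-- A monoidal transformation of strong functors, restricted to the objects and the morphisms
with support in `s`. -/
@[ext]
structure PartialTrans (s : Finset J) (F G : StrongFunctor S X) where
  app (c : S) (hc : D.supp s (𝟙 c)) : F.functor.obj c ⟶ G.functor.obj c
  naturality {c d : S} (f : c ⟶ d) (hf : D.supp s f) :
    F.functor.map f ≫ app d (D.supp_target hf) = app c (D.supp_source hf) ≫ G.functor.map f
  unit : ε F.functor ≫ app (𝟙_ S) (D.supp_unit s) = ε G.functor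
  tensor {c d : S} (hc : D.supp s (𝟙 c)) (hd : D.supp s (𝟙 d)) :
    μ F.functor c d ≫ app (c ⊗ d) (D.supp_tensor hc hd) =
      (app c hc ⊗ₘ app d hd) ≫ μ G.functor c d

namespace PartialTrans

variable {D} {s t : Finset J} {F G H F' G' : StrongFunctor S X}

/-- The restriction of a monoidal transformation. -/
@[simps]
def ofTrans (s : Finset J) (α : F ⟶ G) : D.PartialTrans s F G where
  app c _ := α.natTrans.app c
  naturality f _ := α.natTrans.naturality f
  unit := NatTrans.IsMonoidal.unit
  tensor _ _ := NatTrans.IsMonoidal.tensor _ _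

/-- The composition of partial transformations. -/
@[simps]
def comp (a : D.PartialTrans s F G) (b : D.PartialTrans s G H) : D.PartialTrans s F H where
  app c hc := a.app c hc ≫ b.app c hc
  naturality f hf := by
    rw [← Category.assoc, a.naturality f hf, Category.assoc, b.naturality f hf, Category.assoc]
  unit := by rw [← Category.assoc, a.unit, b.unit]
  tensor hc hd := by
    rw [← Category.assoc, a.tensor hc hd, Category.assoc, b.tensor hc hd,
      ← tensorHom_comp_tensorHom, Category.assoc]

/-- The restriction of a partial transformation to a smaller support. -/
@[simps]
def restrict (h : s ⊆ t) (a : D.PartialTrans t F G) : D.PartialTrans s F G where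
  app c hc := a.app c (D.supp_mono h hc)
  naturality f hf := a.naturality f (D.supp_mono h hf)
  unit := a.unit
  tensor hc hd := a.tensor (D.supp_mono h hc) (D.supp_mono h hd)

/-- The pointwise tensor product of partial transformations. -/
@[simps]
def tensorTrans (a : D.PartialTrans s F G) (b : D.PartialTrans s F' G') :
    D.PartialTrans s (tensorFunctor F F') (tensorFunctor G G') where
  app c hc := a.app c hc ⊗ₘ b.app c hc
  naturality f hf := by
    rw [tensorFunctor_map, tensorFunctor_map]
    erw [tensorHom_comp_tensorHom, tensorHom_comp_tensorHom]
    rw [a.naturality f hf, b.naturality f hf]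
  unit := by
    rw [tensorFunctor_ε, tensorFunctor_ε]
    erw [Category.assoc, tensorHom_comp_tensorHom]
    rw [a.unit, b.unit]
    rfl
  tensor {c d} hc hd := by
    change (tensorμ _ _ _ _ ≫ (μ F.functor c d ⊗ₘ μ F'.functor c d)) ≫ (a.app _ _ ⊗ₘ b.app _ _) =
      ((a.app c hc ⊗ₘ b.app c hc) ⊗ₘ (a.app d hd ⊗ₘ b.app d hd)) ≫
        tensorμ _ _ _ _ ≫ (μ G.functor c d ⊗ₘ μ G'.functor c d)
    rw [reassoc_of% tensorμ_natural, Category.assoc, tensorHom_comp_tensorHom,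
      tensorHom_comp_tensorHom, a.tensor hc hd, b.tensor hc hd]

/-- Precomposition of a partial transformation with the functor that erases an index. -/
@[simps]
def eraseComp (k : J) (a : D.PartialTrans s F G) :
    D.PartialTrans (insert k s) (compFunctor (D.erase k) F) (compFunctor (D.erase k) G) where
  app c hc := a.app ((D.erase k).functor.obj c) (by simpa using D.supp_erase hc)
  naturality f hf := a.naturality _ (D.supp_erase hf)
  unit := by
    change (ε F.functor ≫ F.functor.map (ε (D.erase k).functor)) ≫ a.app _ _ =
      ε G.functor ≫ G.functor.map (ε (D.erase k).functor)
    rw [Category.assoc, a.naturality _ (D.supp_erase_ε k s), ← Category.assoc, a.unit]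
  tensor {c d} hc hd := by
    change (μ F.functor _ _ ≫ F.functor.map (μ (D.erase k).functor c d)) ≫ a.app _ _ =
      (a.app _ _ ⊗ₘ a.app _ _) ≫ μ G.functor _ _ ≫ G.functor.map (μ (D.erase k).functor c d)
    rw [Category.assoc, a.naturality _ (D.supp_erase_μ hc hd), ← Category.assoc, a.tensor,
      Category.assoc]

lemma app_unit (a : D.PartialTrans s F G) : a.app (𝟙_ S) (D.supp_unit s) = unitHom F G := by
  rw [unitHom, ← a.unit, Functor.Monoidal.η_ε_assoc]

lemma app_tensor (a : D.PartialTrans s F G) {c d : S} (hc : D.supp s (𝟙 c))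
    (hd : D.supp s (𝟙 d)) :
    a.app (c ⊗ d) (D.supp_tensor hc hd) = combine (a.app c hc) (a.app d hd) := by
  rw [combine, ← a.tensor, Functor.Monoidal.δ_μ_assoc]

end PartialTrans

lemma supp_incl_map {s : Finset J} {j : J} (hj : j ∈ s) {x y : C j} (f : x ⟶ y) :
    D.supp s ((D.incl j).functor.map f) :=
  D.supp_mono (Finset.singleton_subset_iff.2 hj) (D.supp_incl j f)

lemma supp_incl_obj {s : Finset J} {j : J} (hj : j ∈ s) (x : C j) :
    D.supp s (𝟙 ((D.incl j).functor.obj x)) :=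
  D.supp_source (D.supp_incl_map hj (𝟙 x))

lemma supp_erase_obj {k : J} {s : Finset J} {c : S} (hc : D.supp (insert k s) (𝟙 c)) :
    D.supp s (𝟙 ((D.erase k).functor.obj c)) :=
  D.supp_source (D.supp_erase hc)

variable {D}

/-- A partial transformation is determined by its components at the objects in the images of the
coprojections. -/
lemma PartialTrans.ext_incl {s : Finset J} {F G : StrongFunctor S X} {a b : D.PartialTrans s F G}
    (h : ∀ (j : J) (hj : j ∈ s) (x : C j), a.app _ (D.supp_incl_obj hj x) =
      b.app _ (D.supp_incl_obj hj x)) : a = b := by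
  suffices ∀ t : Finset J, ∀ ht : t ⊆ s, ∀ (c : S) (hc : D.supp t (𝟙 c)),
      a.app c (D.supp_mono ht hc) = b.app c (D.supp_mono ht hc) by
    ext c hc
    exact this s subset_rfl c hc
  intro t
  induction t using Finset.induction_on with
  | empty =>
    intro ht c hc
    obtain ⟨e, he⟩ := D.exists_unitIso hc
    have h₁ := a.naturality _ (D.supp_mono ht he)
    have h₂ := b.naturality _ (D.supp_mono ht he)
    rw [app_unit] at h₁ h₂
    rw [← cancel_mono (G.functor.map e.hom), ← h₁, ← h₂]
  | insert k t hk ih =>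
    intro ht c hc
    have hks : k ∈ s := ht (Finset.mem_insert_self k t)
    have hts : t ⊆ s := (Finset.subset_insert k t).trans ht
    have hd := D.supp_split hks (D.supp_mono ht hc)
    have h₁ := a.naturality _ hd
    have h₂ := b.naturality _ hd
    have hu : D.supp s (𝟙 ((D.incl k).functor.obj ((D.proj k).functor.obj c))) :=
      D.supp_incl_obj hks _
    have hv : D.supp s (𝟙 ((D.erase k).functor.obj c)) :=
      D.supp_mono hts (D.supp_erase_obj hc)
    have e₁ := a.app_tensor hu hv
    have e₂ := b.app_tensor hu hv
    rw [h k hks, ih hts _ (D.supp_erase_obj hc), ← e₂] at e₁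
    have := h₁.symm.trans ((congrArg (fun z => F.functor.map _ ≫ z) e₁).trans h₂)
    have i : IsIso ((D.split k).hom.natTrans.app c) := (appIso (D.split k) c).isIso_hom
    exact (cancel_mono (G.functor.map ((D.split k).hom.natTrans.app c))).1 this

/-- The tensor decomposition of a strong functor on `S`. -/
def splitFunctor (D : Decomposition C S) (k : J) (F : StrongFunctor S X) :
    F ≅ tensorFunctor (compFunctor (D.proj k) (compFunctor (D.incl k) F))
      (compFunctor (D.erase k) F) :=
  (idCompIso F).symm ≪≫ compIsoRight (D.split k) F ≪≫ tensorCompIso _ _ F ≪≫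
    tensorFunctorIso (compAssocIso _ _ _) (Iso.refl _)

lemma splitFunctor_hom_app (k : J) (F : StrongFunctor S X) (c : S) :
    (splitFunctor D k F).hom.natTrans.app c =
      F.functor.map ((D.split k).hom.natTrans.app c) ≫ δ F.functor _ _ := by
  change 𝟙 _ ≫ F.functor.map ((D.split k).hom.natTrans.app c) ≫ δ F.functor _ _ ≫
    (𝟙 _ ⊗ₘ 𝟙 _) = _
  simp

/-- Extension of a partial transformation along an additional index `k`. -/
def PartialTrans.insert {s : Finset J} {F G : StrongFunctor S X} (k : J)
    (α : compFunctor (D.incl k) F ⟶ compFunctor (D.incl k) G) (a : D.PartialTrans s F G) :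
    D.PartialTrans (insert k s) F G :=
  ((ofTrans _ (splitFunctor D k F).hom).comp
    (tensorTrans (ofTrans _ (whiskerLeftTrans (D.proj k) α)) (a.eraseComp k))).comp
      (ofTrans _ (splitFunctor D k G).inv)

lemma PartialTrans.insert_app {s : Finset J} {F G : StrongFunctor S X} (k : J)
    (α : compFunctor (D.incl k) F ⟶ compFunctor (D.incl k) G) (a : D.PartialTrans s F G) (c : S)
    (hc : D.supp (Insert.insert k s) (𝟙 c)) :
    (a.insert k α).app c hc ≫ G.functor.map ((D.split k).hom.natTrans.app c) =
      F.functor.map ((D.split k).hom.natTrans.app c) ≫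
        combine (F := F) (G := G) (X := (D.incl k).functor.obj ((D.proj k).functor.obj c))
          (α.natTrans.app ((D.proj k).functor.obj c)) (a.app _ (D.supp_erase_obj hc)) := by
  have h : (splitFunctor D k G).inv.natTrans.app c ≫
      G.functor.map ((D.split k).hom.natTrans.app c) = μ G.functor _ _ := by
    have h := (appIso (splitFunctor D k G) c).inv_hom_id
    simp only [appIso_hom, appIso_inv, splitFunctor_hom_app] at h
    exact eq_of_comp_eq_id ((Category.assoc _ _ _).trans h) (Functor.Monoidal.δ_μ G.functor _ _)
  refine (Category.assoc _ _ _).trans ((congrArg (_ ≫ ·) h).trans ?_)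
  refine (congrArg (fun z => (z ≫ _) ≫ _) (splitFunctor_hom_app k F c)).trans ?_
  refine (Category.assoc _ _ _).trans ?_
  exact (Category.assoc _ _ _)

lemma exists_partialTrans_empty (F G : StrongFunctor S X) :
    Nonempty (D.PartialTrans ∅ F G) := by
  choose e he using fun (c : S) (hc : D.supp ∅ (𝟙 c)) => D.exists_unitIso hc
  have key {c : S} (hc : D.supp ∅ (𝟙 c)) (f : c ⟶ 𝟙_ S) (hf : D.supp ∅ f) : (e c hc).hom = f :=
    D.eq_of_supp_empty (he c hc) hf
  refine ⟨
    { app c hc := F.functor.map (e c hc).hom ≫ unitHom F G ≫ G.functor.map (e c hc).inv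
      naturality {c d} f hf := ?_
      unit := ?_
      tensor {c d} hc hd := ?_ }⟩
  · have h := key (D.supp_source hf) _ (D.supp_comp hf (he d (D.supp_target hf)))
    have h₁ : F.functor.map (e c (D.supp_source hf)).hom =
        F.functor.map f ≫ F.functor.map (e d (D.supp_target hf)).hom := by
      rw [h, Functor.map_comp]
    have h₂ : G.functor.map (e c (D.supp_source hf)).inv ≫ G.functor.map f ≫
        G.functor.map (e d (D.supp_target hf)).hom = 𝟙 _ := by
      rw [← Functor.map_comp, ← h, ← Functor.map_comp, Iso.inv_hom_id,
        CategoryTheory.Functor.map_id]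
    rw [← cancel_mono (G.functor.map (e d (D.supp_target hf)).hom), h₁]
    simp only [Category.assoc, h₂]
    rw [← Functor.map_comp, Iso.inv_hom_id, CategoryTheory.Functor.map_id]
  · have h := key (D.supp_unit ∅) (𝟙 _) (D.supp_unit ∅)
    have h' : (e _ (D.supp_unit ∅)).inv = 𝟙 _ := by
      rw [← cancel_epi (e _ (D.supp_unit ∅)).hom, Iso.hom_inv_id, h, Category.comp_id]
    rw [h, h']
    simp [unitHom]
  · have h := key (D.supp_tensor hc hd) _
      (D.supp_comp (D.supp_tensorHom (he c hc) (he d hd)) D.supp_leftUnitor)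
    have h₁ := combine_naturality (F := F) (G := G) (e c hc).hom (e d hd).hom
      (β := F.functor.map (e c hc).hom ≫ unitHom F G ≫ G.functor.map (e c hc).inv)
      (γ := F.functor.map (e d hd).hom ≫ unitHom F G ≫ G.functor.map (e d hd).inv)
      (β' := unitHom F G) (γ' := unitHom F G) (by simp [← Functor.map_comp])
      (by simp [← Functor.map_comp])
    have h₂ := map_leftUnitor_inv_combine (unitHom F G)
    have h₃ : F.functor.map (λ_ (𝟙_ S)).hom ≫ unitHom F G =
        combine (unitHom F G) (unitHom F G) ≫ G.functor.map (λ_ (𝟙_ S)).hom := by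
      rw [← cancel_epi (F.functor.map (λ_ (𝟙_ S)).inv), reassoc_of% h₂]
      simp [← Functor.map_comp, ← Functor.map_comp_assoc]
    have h₄ : F.functor.map (e _ (D.supp_tensor hc hd)).hom ≫ unitHom F G ≫
        G.functor.map (e _ (D.supp_tensor hc hd)).inv =
        combine (F.functor.map (e c hc).hom ≫ unitHom F G ≫ G.functor.map (e c hc).inv)
          (F.functor.map (e d hd).hom ≫ unitHom F G ≫ G.functor.map (e d hd).inv) := by
      rw [← cancel_mono (G.functor.map (e _ (D.supp_tensor hc hd)).hom)]
      simp only [Category.assoc, ← Functor.map_comp, Iso.inv_hom_id]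
      rw [CategoryTheory.Functor.map_id, Category.comp_id, h, Functor.map_comp,
        Functor.map_comp, Category.assoc, h₃, reassoc_of% h₁]
    rw [h₄, combine, Functor.Monoidal.μ_δ_assoc]

lemma PartialTrans.insert_app_incl {s : Finset J} {F G : StrongFunctor S X} (k : J)
    (α : compFunctor (D.incl k) F ⟶ compFunctor (D.incl k) G) (a : D.PartialTrans s F G) (x : C k) :
    (a.insert k α).app _ (D.supp_incl_obj (Finset.mem_insert_self k s) x) = α.natTrans.app x := by
  let c := (D.incl k).functor.obj x
  have hc := D.supp_incl_obj (Finset.mem_insert_self k s) x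
  let p : (D.proj k).functor.obj c ⟶ x := (D.inclProj k).hom.natTrans.app x
  let z : (D.erase k).functor.obj c ⟶ 𝟙_ S := (D.inclErase k).hom.natTrans.app x
  have h₁ := a.insert_app k α c hc
  have hp : F.functor.map ((D.incl k).functor.map p) ≫ α.natTrans.app x =
      α.natTrans.app ((D.proj k).functor.obj c) ≫ G.functor.map ((D.incl k).functor.map p) :=
    α.natTrans.naturality p
  have hz : F.functor.map z ≫ unitHom F G = a.app _ (D.supp_erase_obj hc) ≫ G.functor.map z := by
    rw [← a.app_unit]
    exact a.naturality z (D.supp_mono (Finset.empty_subset s) (D.supp_inclErase k x))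
  have h₂ := combine_naturality _ _ hp hz
  exact cancel_split (D.splitIso k c) (((D.incl k).functor.mapIso (appIso (D.inclProj k) x)) ⊗ᵢ
    appIso (D.inclErase k) x) (D.split_incl k x) h₁ h₂ (map_rightUnitor_inv_combine _)

lemma PartialTrans.insert_app_incl_ne {s : Finset J} {F G : StrongFunctor S X} {j k : J}
    (hjk : j ≠ k) (hj : j ∈ s) (α : compFunctor (D.incl k) F ⟶ compFunctor (D.incl k) G)
    (a : D.PartialTrans s F G) (x : C j) :
    (a.insert k α).app _ (D.supp_incl_obj (Finset.mem_insert_of_mem hj) x) =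
      a.app _ (D.supp_incl_obj hj x) := by
  let c := (D.incl j).functor.obj x
  have hc := D.supp_incl_obj (Finset.mem_insert_of_mem (b := k) hj) x
  let p : (D.proj k).functor.obj c ⟶ 𝟙_ (C k) := (D.inclProjNe hjk).hom.natTrans.app x
  let z : (D.erase k).functor.obj c ⟶ c := (D.inclEraseNe hjk).hom.natTrans.app x
  have h₁ := a.insert_app k α c hc
  have hp₁ : F.functor.map ((D.incl k).functor.map p) ≫ α.natTrans.app (𝟙_ (C k)) =
      α.natTrans.app ((D.proj k).functor.obj c) ≫ G.functor.map ((D.incl k).functor.map p) :=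
    α.natTrans.naturality p
  have hp₂ := map_η_unitHom (F := F) (G := G) (H := D.incl k) (α.natTrans.app (𝟙_ (C k)))
    (NatTrans.IsMonoidal.unit (τ := α.natTrans))
  have hp := map_comp_naturality hp₁ hp₂
  have hz : F.functor.map z ≫ a.app c (D.supp_incl_obj hj x) =
      a.app _ (D.supp_erase_obj hc) ≫ G.functor.map z :=
    a.naturality z (D.supp_mono (Finset.singleton_subset_iff.2 hj) (D.supp_inclEraseNe hjk x))
  have h₂ := combine_naturality _ _ hp hz
  exact cancel_split (D.splitIso k c) (((D.incl k).functor.mapIso (appIso (D.inclProjNe hjk) x) ≪≫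
    (Functor.Monoidal.εIso (D.incl k).functor).symm) ⊗ᵢ appIso (D.inclEraseNe hjk) x)
    (D.split_incl_ne hjk x) h₁ h₂ (map_leftUnitor_inv_combine _)

/-- Monoidal transformations on the images of the coprojections extend to partial
transformations. -/
lemma exists_partialTrans (s : Finset J) (F G : StrongFunctor S X)
    (α : ∀ j ∈ s, compFunctor (D.incl j) F ⟶ compFunctor (D.incl j) G) :
    ∃ a : D.PartialTrans s F G, ∀ (j : J) (hj : j ∈ s) (x : C j),
      a.app _ (D.supp_incl_obj hj x) = (α j hj).natTrans.app x := by
  induction s using Finset.induction_on with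
  | empty =>
    obtain ⟨a⟩ := exists_partialTrans_empty (D := D) F G
    exact ⟨a, fun j hj => absurd hj (Finset.notMem_empty j)⟩
  | insert k s hk ih =>
    obtain ⟨a, ha⟩ := ih fun j hj => α j (Finset.mem_insert_of_mem hj)
    refine ⟨a.insert k (α k (Finset.mem_insert_self k s)), fun j hj x => ?_⟩
    rcases eq_or_ne j k with rfl | hjk
    · exact a.insert_app_incl j _ x
    · have hjs := Finset.mem_of_mem_insert_of_ne hj hjk
      rw [a.insert_app_incl_ne hjk hjs]
      exact ha j hjs x

end Decomposition
end SymMonCat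

namespace SymMonCat

open Functor.LaxMonoidal Functor.OplaxMonoidal

variable {J : Type w} [DecidableEq J]

namespace Decomposition

variable {C : J → SymMonCat.{v, u}} {S : SymMonCat.{v, u}} {D : Decomposition C S}
  {X : SymMonCat.{v, u}}

/-- Finitely many strong functors `C j ⥤ X` extend to `S`, up to isomorphism. -/
lemma exists_strongFunctor (D : Decomposition C S) (F : ∀ j, StrongFunctor (C j) X)
    (s : Finset J) :
    ∃ T : StrongFunctor S X, ∀ j ∈ s, Nonempty (compFunctor (D.incl j) T ≅ F j) := by
  induction s using Finset.induction_on with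
  | empty => exact ⟨unitFunctor S X, fun j hj => absurd hj (Finset.notMem_empty j)⟩
  | insert k s hk ih =>
    obtain ⟨T, hT⟩ := ih
    refine ⟨tensorFunctor (compFunctor (D.proj k) (F k)) (compFunctor (D.erase k) T),
      fun j hj => ?_⟩
    rcases eq_or_ne j k with rfl | hjk
    · exact ⟨compTensorIso _ _ _ ≪≫ tensorFunctorIso
        ((compAssocIso _ _ _).symm ≪≫ compIsoRight (D.inclProj j) _ ≪≫ idCompIso _)
        ((compAssocIso _ _ _).symm ≪≫ compIsoRight (D.inclErase j) _ ≪≫ unitCompIso _) ≪≫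
        tensorUnitFunctorIso _⟩
    · obtain ⟨e⟩ := hT j (Finset.mem_of_mem_insert_of_ne hj hjk)
      exact ⟨compTensorIso _ _ _ ≪≫ tensorFunctorIso
        ((compAssocIso _ _ _).symm ≪≫ compIsoRight (D.inclProjNe hjk) _ ≪≫ unitCompIso _)
        ((compAssocIso _ _ _).symm ≪≫ compIsoRight (D.inclEraseNe hjk) _ ≪≫ e) ≪≫
        unitTensorFunctorIso _⟩

lemma trans_ext_incl (D : Decomposition C S) {F G : StrongFunctor S X} {α β : F ⟶ G}
    (h : ∀ j, whiskerLeftTrans (D.incl j) α = whiskerLeftTrans (D.incl j) β) : α = β := by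
  apply trans_ext
  intro c
  obtain ⟨s, hs⟩ := D.exists_supp (𝟙 c)
  have : (PartialTrans.ofTrans s α : D.PartialTrans s F G) = PartialTrans.ofTrans s β :=
    PartialTrans.ext_incl fun j _ x =>
      congrArg (fun γ : compFunctor (D.incl j) F ⟶ compFunctor (D.incl j) G => γ.natTrans.app x)
        (h j)
  exact congrArg (fun γ => γ.app c hs) this

lemma exists_supp₃ (D : Decomposition C S) {c₁ c₂ c₃ d₁ d₂ d₃ : S} (f₁ : c₁ ⟶ d₁) (f₂ : c₂ ⟶ d₂)
    (f₃ : c₃ ⟶ d₃) : ∃ s, D.supp s f₁ ∧ D.supp s f₂ ∧ D.supp s f₃ := by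
  obtain ⟨s₁, h₁⟩ := D.exists_supp f₁
  obtain ⟨s₂, h₂⟩ := D.exists_supp f₂
  obtain ⟨s₃, h₃⟩ := D.exists_supp f₃
  exact ⟨s₁ ∪ (s₂ ∪ s₃), D.supp_mono Finset.subset_union_left h₁,
    D.supp_mono (Finset.subset_union_left.trans Finset.subset_union_right) h₂,
    D.supp_mono (Finset.subset_union_right.trans Finset.subset_union_right) h₃⟩

lemma exists_supp_subset (D : Decomposition C S) (s : Finset J) {c d : S} (f : c ⟶ d) :
    ∃ t, s ⊆ t ∧ D.supp t f := by
  obtain ⟨t, ht⟩ := D.exists_supp f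
  exact ⟨s ∪ t, Finset.subset_union_left, D.supp_mono Finset.subset_union_right ht⟩

lemma exists_trans (D : Decomposition C S) {F G : StrongFunctor S X}
    (α : ∀ j, compFunctor (D.incl j) F ⟶ compFunctor (D.incl j) G) :
    ∃ β : F ⟶ G, ∀ j, whiskerLeftTrans (D.incl j) β = α j := by
  choose a ha using fun s => exists_partialTrans (D := D) s F G fun j _ => α j
  have hres {s t : Finset J} (h : s ⊆ t) : (a t).restrict h = a s :=
    PartialTrans.ext_incl fun j hj x => (ha t j (h hj) x).trans (ha s j hj x).symm
  have hst {s t : Finset J} {c : S} (hs : D.supp s (𝟙 c)) (ht : D.supp t (𝟙 c)) :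
      (a s).app c hs = (a t).app c ht := by
    have h₁ := congrArg (fun b => b.app c hs) (hres (Finset.subset_union_left (s₂ := t)))
    have h₂ := congrArg (fun b => b.app c ht) (hres (Finset.subset_union_right (s₁ := s)))
    exact h₁.symm.trans h₂
  choose σ hσ using fun c : S => D.exists_supp (𝟙 c)
  have hσ' {s : Finset J} {c : S} (hs : D.supp s (𝟙 c)) : (a (σ c)).app c (hσ c) = (a s).app c hs :=
    hst _ _
  refine ⟨MonoidalTrans.mk
    { app c := (a (σ c)).app c (hσ c)
      naturality c d f := ?_ } (isMonoidal := { unit := ?_, tensor c d := ?_ }), fun j => ?_⟩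
  · obtain ⟨s, hs⟩ := D.exists_supp f
    rw [hσ' (D.supp_source hs), hσ' (D.supp_target hs), (a s).naturality f hs]
  · exact (a _).unit
  · obtain ⟨s, hc, hd, -⟩ := D.exists_supp₃ (𝟙 c) (𝟙 d) (𝟙 d)
    change _ ≫ (a (σ (c ⊗ d))).app (c ⊗ d) (hσ _) =
      ((a (σ c)).app c (hσ c) ⊗ₘ (a (σ d)).app d (hσ d)) ≫ _
    rw [hσ' hc, hσ' hd, hσ' (D.supp_tensor hc hd), (a s).tensor hc hd]
  · apply trans_ext
    intro x
    exact (hσ' (D.supp_incl_obj (Finset.mem_singleton_self j) x)).trans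
      (ha {j} j (Finset.mem_singleton_self j) x)

/-- Compatible strong functors `T s`, each of which is only relevant on the objects and the
morphisms with support in `s`. -/
structure Gluing (D : Decomposition C S) (X : SymMonCat.{v, u}) where
  functor (s : Finset J) : StrongFunctor S X
  trans (s t : Finset J) (c : S) (hs : D.supp s (𝟙 c)) (ht : D.supp t (𝟙 c)) :
    (functor s).functor.obj c ⟶ (functor t).functor.obj c
  trans_self (s : Finset J) (c : S) (hs : D.supp s (𝟙 c)) : trans s s c hs hs = 𝟙 _
  trans_comp (s t r : Finset J) (c : S) (hs : D.supp s (𝟙 c)) (ht : D.supp t (𝟙 c))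
    (hr : D.supp r (𝟙 c)) : trans s t c hs ht ≫ trans t r c ht hr = trans s r c hs hr
  naturality (s t : Finset J) {c d : S} (f : c ⟶ d) (hs : D.supp s f) (ht : D.supp t f) :
    (functor s).functor.map f ≫ trans s t d (D.supp_target hs) (D.supp_target ht) =
      trans s t c (D.supp_source hs) (D.supp_source ht) ≫ (functor t).functor.map f
  unit (s t : Finset J) :
    ε (functor s).functor ≫ trans s t (𝟙_ S) (D.supp_unit s) (D.supp_unit t) =
      ε (functor t).functor
  tensor (s t : Finset J) (c d : S) (hcs : D.supp s (𝟙 c)) (hct : D.supp t (𝟙 c))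
    (hds : D.supp s (𝟙 d)) (hdt : D.supp t (𝟙 d)) :
    μ (functor s).functor c d ≫ trans s t (c ⊗ d) (D.supp_tensor hcs hds) (D.supp_tensor hct hdt) =
      (trans s t c hcs hct ⊗ₘ trans s t d hds hdt) ≫ μ (functor t).functor c d

namespace Gluing

variable (T : Gluing D X)

/-- A finite support of an object. -/
noncomputable def support (D : Decomposition C S) (c : S) : Finset J := (D.exists_supp (𝟙 c)).choose

lemma supp_support (c : S) : D.supp (support D c) (𝟙 c) := (D.exists_supp (𝟙 c)).choose_spec

/-- The value of the glued functor at an object. -/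
noncomputable def obj (c : S) : X := (T.functor (support D c)).functor.obj c

/-- The comparison of the glued functor with `T s` at an object with support in `s`. -/
noncomputable def iso (s : Finset J) (c : S) (hs : D.supp s (𝟙 c)) :
    T.obj c ≅ (T.functor s).functor.obj c where
  hom := T.trans _ s c (supp_support c) hs
  inv := T.trans s _ c hs (supp_support c)
  hom_inv_id := (T.trans_comp _ _ _ _ _ _ _).trans (T.trans_self _ _ _)
  inv_hom_id := (T.trans_comp _ _ _ _ _ _ _).trans (T.trans_self _ _ _)

lemma iso_trans (s t : Finset J) (c : S) (hs : D.supp s (𝟙 c)) (ht : D.supp t (𝟙 c)) :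
    (T.iso s c hs).hom ≫ T.trans s t c hs ht = (T.iso t c ht).hom := T.trans_comp _ _ _ _ _ _ _

/-- The action of the glued functor on a morphism. -/
noncomputable def map {c d : S} (f : c ⟶ d) : T.obj c ⟶ T.obj d :=
  (T.iso _ c (D.supp_source (D.exists_supp f).choose_spec)).hom ≫
    (T.functor (D.exists_supp f).choose).functor.map f ≫
      (T.iso _ d (D.supp_target (D.exists_supp f).choose_spec)).inv

lemma map_iso {s : Finset J} {c d : S} (f : c ⟶ d) (hs : D.supp s f) :
    T.map f ≫ (T.iso s d (D.supp_target hs)).hom =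
      (T.iso s c (D.supp_source hs)).hom ≫ (T.functor s).functor.map f := by
  have h := (D.exists_supp f).choose_spec
  rw [← T.iso_trans _ s d (D.supp_target h), map]
  simp only [Category.assoc, Iso.inv_hom_id_assoc]
  rw [T.naturality _ _ f h hs, ← Category.assoc, T.iso_trans]

lemma map_iso' {s : Finset J} {c d : S} (f : c ⟶ d) (hs : D.supp s f) (hc hd) :
    T.map f ≫ (T.iso s d hd).hom = (T.iso s c hc).hom ≫ (T.functor s).functor.map f :=
  T.map_iso f hs

/-- The comparison of units. -/
noncomputable def εIso : 𝟙_ X ≅ T.obj (𝟙_ S) :=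
  Functor.Monoidal.εIso (T.functor ∅).functor ≪≫ (T.iso ∅ (𝟙_ S) (D.supp_unit ∅)).symm

lemma εIso_iso (s : Finset J) (hs) :
    T.εIso.hom ≫ (T.iso s (𝟙_ S) hs).hom = ε (T.functor s).functor := by
  rw [← T.iso_trans ∅ s (𝟙_ S) (D.supp_unit ∅), ← T.unit ∅ s]
  simp only [εIso, Iso.trans_hom, Iso.symm_hom, Category.assoc, Iso.inv_hom_id_assoc,
    Functor.Monoidal.εIso_hom]

lemma exists_supp_pair (c d : S) : ∃ s, D.supp s (𝟙 c) ∧ D.supp s (𝟙 d) := by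
  obtain ⟨s, hc, hd, -⟩ := D.exists_supp₃ (𝟙 c) (𝟙 d) (𝟙 d)
  exact ⟨s, hc, hd⟩

/-- The comparison of tensor products. -/
noncomputable def μIso (c d : S) : T.obj c ⊗ T.obj d ≅ T.obj (c ⊗ d) :=
  have h := (exists_supp_pair (D := D) c d).choose_spec
  (T.iso _ c h.1 ⊗ᵢ T.iso _ d h.2) ≪≫ Functor.Monoidal.μIso (T.functor _).functor c d ≪≫
    (T.iso _ (c ⊗ d) (D.supp_tensor h.1 h.2)).symm

lemma μIso_iso {s : Finset J} {c d : S} (hc : D.supp s (𝟙 c)) (hd : D.supp s (𝟙 d)) (hcd) :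
    (T.μIso c d).hom ≫ (T.iso s (c ⊗ d) hcd).hom =
      ((T.iso s c hc).hom ⊗ₘ (T.iso s d hd).hom) ≫ μ (T.functor s).functor c d := by
  have h := (exists_supp_pair (D := D) c d).choose_spec
  rw [← T.iso_trans _ s (c ⊗ d) (D.supp_tensor h.1 h.2), ← T.iso_trans _ s c h.1,
    ← T.iso_trans _ s d h.2]
  simp only [μIso, Iso.trans_hom, Iso.symm_hom, Category.assoc, Iso.inv_hom_id_assoc,
    Functor.Monoidal.μIso_hom, tensorIso_hom, ← tensorHom_comp_tensorHom]
  rw [T.tensor _ s c d h.1 hc h.2 hd]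

/-- The functor obtained by gluing. -/
@[simps]
noncomputable def gluedFunctor : S ⥤ X where
  obj := T.obj
  map := T.map
  map_id c := by
    obtain ⟨s, hs⟩ := D.exists_supp (𝟙 c)
    rw [← cancel_mono (T.iso s c hs).hom, T.map_iso' _ hs hs]
    simp
  map_comp {c d e} f g := by
    obtain ⟨s, hf, hg, -⟩ := D.exists_supp₃ f g g
    have hfg := D.supp_comp hf hg
    rw [← cancel_mono (T.iso s e (D.supp_target hg)).hom, Category.assoc,
      T.map_iso' _ hg (D.supp_source hg), T.map_iso' _ hfg (D.supp_source hf),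
      ← Category.assoc, T.map_iso' _ hf (D.supp_source hf) (D.supp_source hg),
      Functor.map_comp, Category.assoc]

lemma μIso_natural_left {c d : S} (f : c ⟶ d) (e : S) :
    T.map f ▷ T.obj e ≫ (T.μIso d e).hom = (T.μIso c e).hom ≫ T.map (f ▷ e) := by
  obtain ⟨s, hf, he, -⟩ := D.exists_supp₃ f (𝟙 e) (𝟙 e)
  have hc := D.supp_source hf
  have hd := D.supp_target hf
  have hfe : D.supp s (f ▷ e) := by simpa using D.supp_tensorHom hf he
  rw [← cancel_mono (T.iso s (d ⊗ e) (D.supp_tensor hd he)).hom, Category.assoc,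
    Category.assoc, T.map_iso' _ hfe (D.supp_tensor hc he), T.μIso_iso hd he,
    reassoc_of% T.μIso_iso hc he, ← tensorHom_id, tensorHom_comp_tensorHom_assoc,
    T.map_iso' _ hf hc, ← μ_natural_left, ← tensorHom_id,
    tensorHom_comp_tensorHom_assoc, Category.id_comp, Category.comp_id]

lemma μIso_natural_right {c d : S} (e : S) (f : c ⟶ d) :
    T.obj e ◁ T.map f ≫ (T.μIso e d).hom = (T.μIso e c).hom ≫ T.map (e ◁ f) := by
  obtain ⟨s, hf, he, -⟩ := D.exists_supp₃ f (𝟙 e) (𝟙 e)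
  have hc := D.supp_source hf
  have hd := D.supp_target hf
  have hfe : D.supp s (e ◁ f) := by simpa using D.supp_tensorHom he hf
  rw [← cancel_mono (T.iso s (e ⊗ d) (D.supp_tensor he hd)).hom, Category.assoc,
    Category.assoc, T.map_iso' _ hfe (D.supp_tensor he hc), T.μIso_iso he hd,
    reassoc_of% T.μIso_iso he hc, ← id_tensorHom, tensorHom_comp_tensorHom_assoc,
    T.map_iso' _ hf hc, ← μ_natural_right, ← id_tensorHom,
    tensorHom_comp_tensorHom_assoc, Category.id_comp, Category.comp_id]

lemma μIso_associativity (c d e : S) :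
    (T.μIso c d).hom ▷ T.obj e ≫ (T.μIso (c ⊗ d) e).hom ≫ T.map (α_ c d e).hom =
      (α_ (T.obj c) (T.obj d) (T.obj e)).hom ≫ T.obj c ◁ (T.μIso d e).hom ≫
        (T.μIso c (d ⊗ e)).hom := by
  obtain ⟨t, hc, hd, he⟩ := D.exists_supp₃ (𝟙 c) (𝟙 d) (𝟙 e)
  obtain ⟨s, hs, hα⟩ := D.exists_supp_subset t (α_ c d e).hom
  replace hc := D.supp_mono hs hc
  replace hd := D.supp_mono hs hd
  replace he := D.supp_mono hs he
  have hcd := D.supp_tensor hc hd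
  have hde := D.supp_tensor hd he
  rw [← cancel_mono (T.iso s _ (D.supp_tensor hc hde)).hom]
  simp only [Category.assoc]
  rw [T.map_iso' _ hα (D.supp_tensor hcd he), reassoc_of% T.μIso_iso hcd he,
    T.μIso_iso hc hde, ← tensorHom_id, ← id_tensorHom, tensorHom_comp_tensorHom_assoc,
    tensorHom_comp_tensorHom_assoc, T.μIso_iso hc hd, T.μIso_iso hd he,
    Category.id_comp, Category.id_comp]
  have h₁ := Functor.LaxMonoidal.associativity (T.functor s).functor c d e
  have h₂ := tensorHom_comp_tensorHom ((T.iso s c hc).hom ⊗ₘ (T.iso s d hd).hom)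
    (T.iso s e he).hom (μ (T.functor s).functor c d) (𝟙 _)
  have h₃ := tensorHom_comp_tensorHom (T.iso s c hc).hom
    ((T.iso s d hd).hom ⊗ₘ (T.iso s e he).hom) (𝟙 _) (μ (T.functor s).functor d e)
  rw [Category.comp_id, tensorHom_id] at h₂
  rw [Category.comp_id, id_tensorHom] at h₃
  rw [← h₂, ← h₃, Category.assoc, Category.assoc, h₁, associator_naturality_assoc]

lemma εIso_left_unitality (c : S) :
    (λ_ (T.obj c)).hom = T.εIso.hom ▷ T.obj c ≫ (T.μIso (𝟙_ S) c).hom ≫ T.map (λ_ c).hom := by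
  obtain ⟨s, hl⟩ := D.exists_supp (λ_ c).hom
  have hc := D.supp_target hl
  have h₁ := D.supp_unit s
  rw [← cancel_mono (T.iso s c hc).hom]
  simp only [Category.assoc]
  rw [T.map_iso' _ hl (D.supp_source hl), reassoc_of% T.μIso_iso h₁ hc, ← tensorHom_id,
    tensorHom_comp_tensorHom_assoc, T.εIso_iso, Category.id_comp,
    MonoidalCategory.tensorHom_def', Category.assoc,
    ← Functor.LaxMonoidal.left_unitality, leftUnitor_naturality]

lemma εIso_right_unitality (c : S) :
    (ρ_ (T.obj c)).hom = T.obj c ◁ T.εIso.hom ≫ (T.μIso c (𝟙_ S)).hom ≫ T.map (ρ_ c).hom := by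
  obtain ⟨s, hr⟩ := D.exists_supp (ρ_ c).hom
  have hc := D.supp_target hr
  have h₁ := D.supp_unit s
  rw [← cancel_mono (T.iso s c hc).hom]
  simp only [Category.assoc]
  rw [T.map_iso' _ hr (D.supp_source hr), reassoc_of% T.μIso_iso hc h₁, ← id_tensorHom,
    tensorHom_comp_tensorHom_assoc, T.εIso_iso, Category.id_comp,
    MonoidalCategory.tensorHom_def, Category.assoc,
    ← Functor.LaxMonoidal.right_unitality, rightUnitor_naturality]

lemma μIso_braiding (c d : S) :
    (T.μIso c d).hom ≫ T.map (β_ c d).hom = (β_ (T.obj c) (T.obj d)).hom ≫ (T.μIso d c).hom := by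
  obtain ⟨t, hc, hd, -⟩ := D.exists_supp₃ (𝟙 c) (𝟙 d) (𝟙 d)
  obtain ⟨s, hs, hβ⟩ := D.exists_supp_subset t (β_ c d).hom
  replace hc := D.supp_mono hs hc
  replace hd := D.supp_mono hs hd
  rw [← cancel_mono (T.iso s _ (D.supp_tensor hd hc)).hom, Category.assoc, Category.assoc,
    T.map_iso' _ hβ (D.supp_tensor hc hd), reassoc_of% T.μIso_iso hc hd, T.μIso_iso hd hc,
    Functor.LaxBraided.braided, ← BraidedCategory.braiding_naturality_assoc]

/-- The strong functor obtained by gluing. -/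
noncomputable def glue : StrongFunctor S X where
  functor := T.gluedFunctor
  braided :=
    { toMonoidal := Functor.CoreMonoidal.toMonoidal
        { εIso := T.εIso
          μIso := T.μIso
          μIso_hom_natural_left := T.μIso_natural_left
          μIso_hom_natural_right := T.μIso_natural_right
          associativity := T.μIso_associativity
          left_unitality := T.εIso_left_unitality
          right_unitality := T.εIso_right_unitality }
      braided := T.μIso_braiding }

/-- Compatible isomorphisms identify the restriction of the glued functor along a coprojection. -/
noncomputable def inclGlueIso (j : J) (F : StrongFunctor (C j) X)
    (e : ∀ s, j ∈ s → (compFunctor (D.incl j) (T.functor s) ≅ F))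
    (he : ∀ (s t : Finset J) (hs : j ∈ s) (ht : j ∈ t) (x : C j),
      T.trans s t _ (D.supp_incl_obj hs x) (D.supp_incl_obj ht x) ≫
        (e t ht).hom.natTrans.app x = (e s hs).hom.natTrans.app x) :
    compFunctor (D.incl j) T.glue ≅ F :=
  have hj := Finset.mem_singleton_self j
  let e' (s : Finset J) (hs : j ∈ s) (x : C j) :
      (T.functor s).functor.obj ((D.incl j).functor.obj x) ≅ F.functor.obj x := appIso (e s hs) x
  have key {s : Finset J} (hs : j ∈ s) (x : C j) :
      (T.iso {j} _ (D.supp_incl_obj hj x)).hom ≫ (e' {j} hj x).hom =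
        (T.iso s _ (D.supp_incl_obj hs x)).hom ≫ (e' s hs x).hom := by
    have h : T.trans {j} s _ (D.supp_incl_obj hj x) (D.supp_incl_obj hs x) ≫ (e' s hs x).hom =
      (e' {j} hj x).hom := he {j} s hj hs x
    rw [← h, ← Category.assoc, T.iso_trans]
  isoOfComponents (F := compFunctor (D.incl j) T.glue) (G := F)
    (fun x => T.iso {j} _ (D.supp_incl_obj hj x) ≪≫ e' {j} hj x)
    (fun {x y} f => by
      have h₁ := T.map_iso _ (D.supp_incl j f)
      have h₂ : (T.functor {j}).functor.map ((D.incl j).functor.map f) ≫ (e' {j} hj y).hom =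
        (e' {j} hj x).hom ≫ F.functor.map f := (e {j} hj).hom.natTrans.naturality f
      change T.map ((D.incl j).functor.map f) ≫ (T.iso {j} _ (D.supp_incl_obj hj y)).hom ≫
        (e' {j} hj y).hom = ((T.iso {j} _ (D.supp_incl_obj hj x)).hom ≫ (e' {j} hj x).hom) ≫
          F.functor.map f
      rw [reassoc_of% h₁, h₂, Category.assoc])
    (by
      obtain ⟨s, hs, h⟩ := D.exists_supp_subset {j} (ε (D.incl j).functor)
      have hjs := Finset.singleton_subset_iff.1 hs
      have h₂ : (ε (T.functor s).functor ≫ (T.functor s).functor.map (ε (D.incl j).functor)) ≫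
        (e' s hjs (𝟙_ (C j))).hom = ε F.functor :=
        NatTrans.IsMonoidal.unit (τ := (e s hjs).hom.natTrans)
      change (T.εIso.hom ≫ T.map (ε (D.incl j).functor)) ≫
        (T.iso {j} _ (D.supp_incl_obj hj _)).hom ≫ (e' {j} hj _).hom = ε F.functor
      rw [key hjs, Category.assoc, reassoc_of% T.map_iso _ h, ← h₂,
        reassoc_of% T.εIso_iso s (D.supp_unit s), Category.assoc])
    (fun x y => by
      obtain ⟨s, hs, h⟩ := D.exists_supp_subset {j} (μ (D.incl j).functor x y)
      have hjs := Finset.singleton_subset_iff.1 hs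
      have h₂ : (μ (T.functor s).functor _ _ ≫
          (T.functor s).functor.map (μ (D.incl j).functor x y)) ≫ (e' s hjs (x ⊗ y)).hom =
          ((e' s hjs x).hom ⊗ₘ (e' s hjs y).hom) ≫ μ F.functor x y :=
        NatTrans.IsMonoidal.tensor (τ := (e s hjs).hom.natTrans) x y
      change ((T.μIso _ _).hom ≫ T.map (μ (D.incl j).functor x y)) ≫
        (T.iso {j} _ (D.supp_incl_obj hj _)).hom ≫ (e' {j} hj _).hom =
        (((T.iso {j} _ (D.supp_incl_obj hj _)).hom ≫ (e' {j} hj _).hom) ⊗ₘ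
          ((T.iso {j} _ (D.supp_incl_obj hj _)).hom ≫ (e' {j} hj _).hom)) ≫ μ F.functor x y
      rw [key hjs, key hjs, key hjs, Category.assoc, reassoc_of% T.map_iso _ h,
        reassoc_of% T.μIso_iso (D.supp_incl_obj hjs x) (D.supp_incl_obj hjs y),
        ← tensorHom_comp_tensorHom, Category.assoc, ← h₂, Category.assoc])

/-- Every family of strong functors `C j ⥤ X` extends to `S`, up to isomorphism. -/
lemma exists_strongFunctor_incl (F : ∀ j, StrongFunctor (C j) X) :
    ∃ G : StrongFunctor S X, ∀ j, Nonempty (compFunctor (D.incl j) G ≅ F j) := by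
  choose T hT using D.exists_strongFunctor F
  let e (s : Finset J) (j : J) (hj : j ∈ s) : compFunctor (D.incl j) (T s) ≅ F j :=
    (hT s j hj).some
  choose θ hθ using fun s t => exists_partialTrans (D := D) (s ∩ t) (T s) (T t) fun j hj =>
    (e s j (Finset.mem_of_mem_inter_left hj)).hom ≫ (e t j (Finset.mem_of_mem_inter_right hj)).inv
  let G : Gluing D X :=
    { functor := T
      trans s t c hs ht := (θ s t).app c (D.supp_inter hs ht)
      trans_self s c hs := by
        have h : θ s s = PartialTrans.ofTrans (s ∩ s) (𝟙 (T s)) :=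
          PartialTrans.ext_incl fun j hj x =>
            (hθ s s j hj x).trans (appIso (e s j (Finset.mem_of_mem_inter_left hj)) x).hom_inv_id
        rw [h]
        rfl
      trans_comp s t r c hs ht hr := by
        have h₁ : s ∩ t ∩ r ⊆ s ∩ t := Finset.inter_subset_left
        have h₂ : s ∩ t ∩ r ⊆ t ∩ r := Finset.inter_subset_inter_right Finset.inter_subset_right
        have h₃ : s ∩ t ∩ r ⊆ s ∩ r := Finset.inter_subset_inter_right Finset.inter_subset_left
        have h : ((θ s t).restrict h₁).comp ((θ t r).restrict h₂) = (θ s r).restrict h₃ :=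
          PartialTrans.ext_incl fun j hj x => by
            have hs := Finset.mem_of_mem_inter_left (h₁ hj)
            have ht := Finset.mem_of_mem_inter_right (h₁ hj)
            have hr := Finset.mem_of_mem_inter_right hj
            refine (congrArg₂ (· ≫ ·) (hθ s t j (h₁ hj) x) (hθ t r j (h₂ hj) x)).trans
              (Eq.trans ?_ (hθ s r j (h₃ hj) x).symm)
            exact congrArg (fun γ : compFunctor (D.incl j) (T s) ⟶ compFunctor (D.incl j) (T r) =>
              γ.natTrans.app x) (show ((e s j hs).hom ≫ (e t j ht).inv) ≫
                (e t j ht).hom ≫ (e r j hr).inv = (e s j hs).hom ≫ (e r j hr).inv by simp)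
        exact congrArg (fun a => a.app c (D.supp_inter (D.supp_inter hs ht) hr)) h
      naturality s t c d f hs ht := (θ s t).naturality f (D.supp_inter hs ht)
      unit s t := (θ s t).unit
      tensor s t c d hcs hct hds hdt :=
        (θ s t).tensor (D.supp_inter hcs hct) (D.supp_inter hds hdt) }
  refine ⟨G.glue, fun j => ⟨G.inclGlueIso j (F j) (fun s hj => e s j hj) fun s t hs ht x => ?_⟩⟩
  have h := hθ s t j (Finset.mem_inter.2 ⟨hs, ht⟩) x
  refine (congrArg (· ≫ (e t j ht).hom.natTrans.app x) h).trans ?_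
  exact congrArg (fun γ : compFunctor (D.incl j) (T s) ⟶ F j => γ.natTrans.app x)
    (show ((e s j hs).hom ≫ (e t j ht).inv) ≫ (e t j ht).hom = (e s j hs).hom by simp)

end Gluing

/-- The coprojections of a decomposition exhibit `S` as a 2-coproduct. -/
theorem isTwoCoproduct (D : Decomposition C S) :
    IsTwoCoproduct (B := SymMonCat.{v, u}) (A := C) (S := S) D.incl := by
  intro X
  exact
    { faithful :=
        { map_injective := fun {F G} α β h => D.trans_ext_incl (F := F) (G := G)
            fun j => congrFun h j }
      full :=
        { map_surjective := fun {F G} α => by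
            obtain ⟨β, hβ⟩ := D.exists_trans (F := F) (G := G) α
            exact ⟨β, funext hβ⟩ }
      essSurj :=
        { mem_essImage := fun F => by
            obtain ⟨G, hG⟩ := Gluing.exists_strongFunctor_incl (D := D) F
            exact ⟨G, ⟨Pi.isoMk fun j => (hG j).some⟩⟩ } }

end Decomposition
end SymMonCat

namespace SymMonCat

open Functor.LaxMonoidal Functor.OplaxMonoidal Filter

section EqToHom

/-- A morphism is an equality morphism if it is of the form `eqToHom h`. -/
def IsEqToHom {A : Type*} [Category* A] {X Y : A} (f : X ⟶ Y) : Prop := ∃ h : X = Y, f = eqToHom h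

variable {A : Type*} [Category* A] {X Y Z : A}

lemma IsEqToHom.comp {f : X ⟶ Y} {g : Y ⟶ Z} (hf : IsEqToHom f) (hg : IsEqToHom g) :
    IsEqToHom (f ≫ g) := by
  obtain ⟨rfl, rfl⟩ := hf
  obtain ⟨rfl, rfl⟩ := hg
  exact ⟨rfl, by simp⟩

lemma IsEqToHom.map {B : Type*} [Category* B] (F : A ⥤ B) {f : X ⟶ Y} (hf : IsEqToHom f) :
    IsEqToHom (F.map f) := by
  obtain ⟨rfl, rfl⟩ := hf
  exact ⟨rfl, by simp⟩

lemma IsEqToHom.ext {f g : X ⟶ Y} (hf : IsEqToHom f) (hg : IsEqToHom g) : f = g := by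
  obtain ⟨_, rfl⟩ := hf
  obtain ⟨_, rfl⟩ := hg
  rfl

lemma isEqToHom_id (X : A) : IsEqToHom (𝟙 X) := ⟨rfl, rfl⟩

lemma IsEqToHom.isUnitId {A : Type u} [Category.{v} A] [MonoidalCategory A] {X Y : A} {f : X ⟶ Y}
    (hf : IsEqToHom f) (hX : X = 𝟙_ A) : IsUnitId f := by
  obtain ⟨h, rfl⟩ := hf
  exact ⟨hX, h.symm.trans hX, rfl⟩

lemma IsEqToHom.isUnitId_of_target {A : Type u} [Category.{v} A] [MonoidalCategory A] {X Y : A}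
    {f : X ⟶ Y} (hf : IsEqToHom f) (hY : Y = 𝟙_ A) : IsUnitId f := by
  obtain ⟨h, rfl⟩ := hf
  exact ⟨h.trans hY, hY, rfl⟩

lemma isEqToHom_eqToHom_app {A B : SymMonCat.{v, u}} {F G : StrongFunctor A B} (h : F = G) (X : A) :
    IsEqToHom ((eqToIso h).hom.natTrans.app X) :=
  ⟨_, eqToHom_natTrans_app h X⟩

lemma isEqToHom_eqToIso_inv_app {A B : SymMonCat.{v, u}} {F G : StrongFunctor A B} (h : F = G)
    (X : A) : IsEqToHom ((eqToIso h).inv.natTrans.app X) :=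
  ⟨_, eqToHom_natTrans_app h.symm X⟩

lemma comp_eq_of_iso_comp_eq {P Q R P' Q' R' : A} (a : P ≅ Q) {m : Q ⟶ R} {e : R ⟶ R'} {t : P ⟶ P'}
    {b : P' ⟶ Q'} {m' : Q' ⟶ R'} (h : (a.hom ≫ m) ≫ e = t ≫ b ≫ m') :
    m ≫ e = (a.inv ≫ t ≫ b) ≫ m' := by
  rw [← cancel_epi a.hom, ← Category.assoc, h]
  simp

end EqToHom

section Coproduct

variable {J : Type w} {C : J → SymMonCat.{max w v, max w u}} {A : SymMonCat.{max w v, max w u}}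

/-- A family of strong functors that is pointwise finitely supported induces a strong functor to
the coproduct. -/
noncomputable def liftCoprod (F : ∀ j, StrongFunctor A (C j))
    (hobj : ∀ X, ∀ᶠ j in cofinite, (F j).functor.obj X = 𝟙_ (C j))
    (hmap : ∀ {X Y : A} (f : X ⟶ Y), ∀ᶠ j in cofinite, IsUnitId ((F j).functor.map f))
    (hε : ∀ᶠ j in cofinite, IsUnitId (ε (F j).functor))
    (hμ : ∀ X Y, ∀ᶠ j in cofinite, IsUnitId ((unitTensorIso _ _).inv ≫ μ (F j).functor X Y)) :
    StrongFunctor A (coprod C) :=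
  StrongFunctor.mk (C := A) (D := coprod C)
    { obj X := CoprodObj.mk (fun j => (F j).functor.obj X) (hobj X)
      map f := CoprodObj.Hom.mk (fun j => (F j).functor.map f) (hmap f)
      map_id X := by apply CoprodObj.hom_ext; intro j; exact (F j).functor.map_id X
      map_comp f g := by apply CoprodObj.hom_ext; intro j; exact (F j).functor.map_comp f g }
    (braided :=
      { toMonoidal := Functor.CoreMonoidal.toMonoidal
          { εIso := CoprodObj.mkIso (fun j => Functor.Monoidal.εIso (F j).functor) hε
            μIso X Y := CoprodObj.mkIso
              (fun j => (unitTensorIso _ _).symm ≪≫ Functor.Monoidal.μIso (F j).functor X Y)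
              (hμ X Y)
            μIso_hom_natural_left {X Y} f Z := by
              apply CoprodObj.hom_ext
              intro j
              let G := (F j).functor
              change ((unitTensorIso _ _).inv ≫ (G.map f ▷ G.obj Z) ≫ (unitTensorIso _ _).hom) ≫
                (unitTensorIso _ _).inv ≫ μ G Y Z =
                  ((unitTensorIso _ _).inv ≫ μ G X Z) ≫ G.map (f ▷ Z)
              simp
            μIso_hom_natural_right {X Y} Z f := by
              apply CoprodObj.hom_ext
              intro j
              let G := (F j).functor
              change ((unitTensorIso _ _).inv ≫ (G.obj Z ◁ G.map f) ≫ (unitTensorIso _ _).hom) ≫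
                (unitTensorIso _ _).inv ≫ μ G Z Y =
                  ((unitTensorIso _ _).inv ≫ μ G Z X) ≫ G.map (Z ◁ f)
              simp
            associativity X Y Z := by
              apply CoprodObj.hom_ext
              intro j
              let G := (F j).functor
              change ((unitTensorIso _ _).inv ≫ (((unitTensorIso _ _).inv ≫ μ G X Y) ▷ G.obj Z) ≫
                  (unitTensorIso _ _).hom) ≫ ((unitTensorIso _ _).inv ≫ μ G (X ⊗ Y) Z) ≫
                    G.map (α_ X Y Z).hom =
                (unitAssoc (G.obj X) (G.obj Y) (G.obj Z)).hom ≫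
                  ((unitTensorIso _ _).inv ≫ (G.obj X ◁ ((unitTensorIso _ _).inv ≫ μ G Y Z)) ≫
                    (unitTensorIso _ _).hom) ≫ ((unitTensorIso _ _).inv ≫ μ G X (Y ⊗ Z))
              simp [unitAssoc]
            left_unitality X := by
              apply CoprodObj.hom_ext
              intro j
              let G := (F j).functor
              change (unitLeftUnitor (G.obj X)).hom =
                ((unitTensorIso _ _).inv ≫ (ε G ▷ G.obj X) ≫ (unitTensorIso _ _).hom) ≫
                  ((unitTensorIso _ _).inv ≫ μ G (𝟙_ A) X) ≫ G.map (λ_ X).hom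
              simp [unitLeftUnitor]
            right_unitality X := by
              apply CoprodObj.hom_ext
              intro j
              let G := (F j).functor
              change (unitRightUnitor (G.obj X)).hom =
                ((unitTensorIso _ _).inv ≫ (G.obj X ◁ ε G) ≫ (unitTensorIso _ _).hom) ≫
                  ((unitTensorIso _ _).inv ≫ μ G X (𝟙_ A)) ≫ G.map (ρ_ X).hom
              simp [unitRightUnitor] }
        braided X Y := by
          apply CoprodObj.hom_ext
          intro j
          let G := (F j).functor
          change ((unitTensorIso _ _).inv ≫ μ G X Y) ≫ G.map (β_ X Y).hom =
            (unitBraiding (G.obj X) (G.obj Y)).hom ≫ (unitTensorIso _ _).inv ≫ μ G Y X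
          simp [unitBraiding] })

/-- The projections from the coproduct. -/
noncomputable def coprodProj (C : J → SymMonCat.{max w v, max w u}) (j : J) :
    StrongFunctor (coprod C) (C j) :=
  StrongFunctor.mk (C := coprod C) (D := C j)
    { obj c := CoprodObj.obj c j
      map f := CoprodObj.Hom.app f j }
    (braided :=
      { toMonoidal := Functor.CoreMonoidal.toMonoidal
          { εIso := Iso.refl (𝟙_ (C j))
            μIso c d := unitTensorIso (CoprodObj.obj c j) (CoprodObj.obj d j)
            μIso_hom_natural_left {c d} f e := by
              change CoprodObj.Hom.app f j ▷ CoprodObj.obj e j ≫ (unitTensorIso _ _).hom =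
                (unitTensorIso _ _).hom ≫ (unitTensorIso _ _).inv ≫
                  CoprodObj.Hom.app f j ▷ CoprodObj.obj e j ≫ (unitTensorIso _ _).hom
              simp
            μIso_hom_natural_right {c d} e f := by
              change CoprodObj.obj e j ◁ CoprodObj.Hom.app f j ≫ (unitTensorIso _ _).hom =
                (unitTensorIso _ _).hom ≫ (unitTensorIso _ _).inv ≫
                  CoprodObj.obj e j ◁ CoprodObj.Hom.app f j ≫ (unitTensorIso _ _).hom
              simp
            associativity c d e := by
              change (unitTensorIso _ _).hom ▷ CoprodObj.obj e j ≫ (unitTensorIso _ _).hom ≫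
                  (unitAssoc (CoprodObj.obj c j) (CoprodObj.obj d j) (CoprodObj.obj e j)).hom =
                (α_ _ _ _).hom ≫ CoprodObj.obj c j ◁ (unitTensorIso _ _).hom ≫
                  (unitTensorIso _ _).hom
              simp [unitAssoc]
            left_unitality c := by
              change (λ_ (CoprodObj.obj c j)).hom = 𝟙 _ ▷ CoprodObj.obj c j ≫
                (unitTensorIso _ _).hom ≫ (unitLeftUnitor (CoprodObj.obj c j)).hom
              simp [unitLeftUnitor]
            right_unitality c := by
              change (ρ_ (CoprodObj.obj c j)).hom = CoprodObj.obj c j ◁ 𝟙 _ ≫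
                (unitTensorIso _ _).hom ≫ (unitRightUnitor (CoprodObj.obj c j)).hom
              simp [unitRightUnitor] }
        braided c d := by
          change (unitTensorIso _ _).hom ≫
            (unitBraiding (CoprodObj.obj c j) (CoprodObj.obj d j)).hom =
              (β_ _ _).hom ≫ (unitTensorIso _ _).hom
          simp [unitBraiding] })

/-- An isomorphism of strong functors to the coproduct from its components. -/
noncomputable def coprodIso {G G' : StrongFunctor A (coprod C)}
    (e : ∀ j, compFunctor G (coprodProj C j) ≅ compFunctor G' (coprodProj C j))
    (h : ∀ X, ∀ᶠ j in cofinite, IsUnitId ((e j).hom.natTrans.app X)) : G ≅ G' :=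
  isoOfComponents (F := G) (G := G')
    (fun X => CoprodObj.mkIso (c := G.functor.obj X) (d := G'.functor.obj X)
      (fun j => appIso (e j) X) (h X))
    (fun {X Y} f => by
      apply CoprodObj.hom_ext
      intro j
      exact (e j).hom.natTrans.naturality f)
    (by
      apply CoprodObj.hom_ext
      intro j
      have h : (𝟙 _ ≫ CoprodObj.Hom.app (ε G.functor) j) ≫ (e j).hom.natTrans.app (𝟙_ A) =
        𝟙 _ ≫ CoprodObj.Hom.app (ε G'.functor) j :=
        NatTrans.IsMonoidal.unit (τ := (e j).hom.natTrans)
      rw [Category.id_comp] at h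
      erw [Category.id_comp] at h
      exact h)
    (fun X Y => by
      apply CoprodObj.hom_ext
      intro j
      have h : ((unitTensorIso _ _).hom ≫ CoprodObj.Hom.app (μ G.functor X Y) j) ≫
          (e j).hom.natTrans.app (X ⊗ Y) =
        ((e j).hom.natTrans.app X ⊗ₘ (e j).hom.natTrans.app Y) ≫
          (unitTensorIso _ _).hom ≫ CoprodObj.Hom.app (μ G'.functor X Y) j :=
        NatTrans.IsMonoidal.tensor (τ := (e j).hom.natTrans) X Y
      change CoprodObj.Hom.app (μ G.functor X Y) j ≫ (e j).hom.natTrans.app (X ⊗ Y) =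
        ((unitTensorIso _ _).inv ≫ ((e j).hom.natTrans.app X ⊗ₘ (e j).hom.natTrans.app Y) ≫
          (unitTensorIso _ _).hom) ≫ CoprodObj.Hom.app (μ G'.functor X Y) j
      exact comp_eq_of_iso_comp_eq (unitTensorIso _ _) h)

/-- Strong functors to the coproduct with equal components are isomorphic. -/
noncomputable def coprodIsoOfEq {G G' : StrongFunctor A (coprod C)}
    (h : ∀ j, compFunctor G (coprodProj C j) = compFunctor G' (coprodProj C j)) : G ≅ G' :=
  coprodIso (fun j => eqToIso (h j)) fun X => (CoprodObj.finite (G.functor.obj X)).mono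
    fun j hj => (isEqToHom_eqToHom_app (h j) X).isUnitId hj

lemma isEqToHom_coprodIsoOfEq {G G' : StrongFunctor A (coprod C)}
    (h : ∀ j, compFunctor G (coprodProj C j) = compFunctor G' (coprodProj C j)) (X : A) (j : J) :
    IsEqToHom (CoprodObj.Hom.app ((coprodIsoOfEq h).hom.natTrans.app X) j) :=
  isEqToHom_eqToHom_app (h j) X

lemma compFunctor_assoc {A B D E : SymMonCat.{v, u}} (F : StrongFunctor A B)
    (G : StrongFunctor B D) (H : StrongFunctor D E) :
    compFunctor (compFunctor F G) H = compFunctor F (compFunctor G H) :=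
  Bicategory.Strict.assoc (B := SymMonCat.{v, u}) F G H

lemma compFunctor_id {A B : SymMonCat.{v, u}} (F : StrongFunctor A B) :
    compFunctor F (idFunctor B) = F :=
  Bicategory.Strict.comp_id (B := SymMonCat.{v, u}) F

lemma compFunctor_unitFunctor {A B D : SymMonCat.{v, u}} (F : StrongFunctor A B) :
    compFunctor F (unitFunctor B D) = unitFunctor A D :=
  strongFunctor_ext (F := (unitFunctor A D).functor) (compFunctor F (unitFunctor B D)).braided
    (unitFunctor A D).braided (Category.comp_id (𝟙 (𝟙_ D)))
    (fun _ _ => Category.comp_id (λ_ (𝟙_ D)).hom)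

lemma liftCoprod_comp_coprodProj (F : ∀ j, StrongFunctor A (C j)) (h₁ h₂ h₃ h₄) (j : J) :
    compFunctor (liftCoprod F h₁ h₂ h₃ h₄) (coprodProj C j) = F j :=
  strongFunctor_ext (F := (F j).functor)
    (compFunctor (liftCoprod F h₁ h₂ h₃ h₄) (coprodProj C j)).braided (F j).braided
    (Category.id_comp (ε (F j).functor))
    (fun _ _ => Iso.hom_inv_id_assoc (unitTensorIso _ _) (μ (F j).functor _ _))

lemma toCoprod_comp_coprodProj (F : ∀ j, StrongFunctor A (C j)) (hF) (j : J) :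
    compFunctor (toCoprod F hF) (coprodProj C j) = F j :=
  strongFunctor_ext (F := (F j).functor)
    (compFunctor (toCoprod F hF) (coprodProj C j)).braided (F j).braided
    (Category.id_comp (ε (F j).functor))
    (fun _ _ => Iso.hom_inv_id_assoc (unitTensorIso _ _) (μ (F j).functor _ _))

lemma unitFunctor_comp_coprodProj (j : J) :
    compFunctor (unitFunctor A (coprod C)) (coprodProj C j) = unitFunctor A (C j) :=
  strongFunctor_ext (F := (unitFunctor A (C j)).functor)
    (compFunctor (unitFunctor A (coprod C)) (coprodProj C j)).braided
    (unitFunctor A (C j)).braided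
    (Category.id_comp (𝟙 (𝟙_ (C j))))
    (fun _ _ => Iso.hom_inv_id_assoc (unitTensorIso (𝟙_ (C j)) (𝟙_ (C j))) (λ_ (𝟙_ (C j))).hom)

open Classical in
/-- The components of the functor that erases the component at `k`. -/
noncomputable def eraseComponent (C : J → SymMonCat.{max w v, max w u}) (k j : J) :
    StrongFunctor (coprod C) (C j) :=
  if j = k then unitFunctor (coprod C) (C j) else coprodProj C j

lemma eraseComponent_self (k : J) :
    eraseComponent C k k = unitFunctor (coprod C) (C k) := if_pos rfl

lemma eraseComponent_of_ne {j k : J} (h : j ≠ k) :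
    eraseComponent C k j = coprodProj C j := if_neg h

lemma eraseComponent_obj_eq_unit {k j : J} {c : coprod C}
    (hc : j ≠ k → CoprodObj.obj c j = 𝟙_ (C j)) :
    (eraseComponent C k j).functor.obj c = 𝟙_ (C j) := by
  rcases eq_or_ne j k with rfl | h
  · rw [eraseComponent_self]
    rfl
  · rw [eraseComponent_of_ne h]
    exact hc h

lemma isUnitId_eraseComponent_map {k j : J} {c d : coprod C} {f : c ⟶ d}
    (hf : j ≠ k → IsUnitId (CoprodObj.Hom.app f j)) :
    IsUnitId ((eraseComponent C k j).functor.map f) := by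
  rcases eq_or_ne j k with rfl | h
  · exact isUnitId_map (eraseComponent_self j) f
  · rw [eraseComponent_of_ne h]
    exact hf h

lemma isUnitId_eraseComponent_ε (k j : J) : IsUnitId (ε (eraseComponent C k j).functor) := by
  rcases eq_or_ne j k with rfl | h
  · exact isUnitId_ε (eraseComponent_self j)
  · rw [eraseComponent_of_ne h]
    exact ⟨rfl, rfl, rfl⟩

lemma isUnitId_eraseComponent_μ {k j : J} {c d : coprod C}
    (hc : j ≠ k → CoprodObj.obj c j = 𝟙_ (C j)) (hd : j ≠ k → CoprodObj.obj d j = 𝟙_ (C j)) :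
    IsUnitId ((unitTensorIso _ _).inv ≫ μ (eraseComponent C k j).functor c d) := by
  rcases eq_or_ne j k with rfl | h
  · exact isUnitId_μ (eraseComponent_self j) c d
  · rw [eraseComponent_of_ne h]
    have e : (unitTensorIso (CoprodObj.obj c j) (CoprodObj.obj d j)).inv ≫
        μ (coprodProj C j).functor c d = 𝟙 _ :=
      (unitTensorIso (CoprodObj.obj c j) (CoprodObj.obj d j)).inv_hom_id
    exact (congrArg IsUnitId e).mpr (isUnitId_id (unitTensor_unit (hc h) (hd h)))

/-- The functor that replaces the component at `k` by the unit. -/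
noncomputable def eraseCoprod (C : J → SymMonCat.{max w v, max w u}) (k : J) :
    StrongFunctor (coprod C) (coprod C) :=
  liftCoprod (eraseComponent C k)
    (fun c => (CoprodObj.finite c).mono fun _ h => eraseComponent_obj_eq_unit fun _ => h)
    (fun f => (CoprodObj.Hom.finite f).mono fun _ h => isUnitId_eraseComponent_map fun _ => h)
    (Eventually.of_forall fun j => isUnitId_eraseComponent_ε k j)
    (fun c d => by
      filter_upwards [CoprodObj.finite c, CoprodObj.finite d] with j hc hd
      exact isUnitId_eraseComponent_μ (fun _ => hc) fun _ => hd)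

lemma eraseCoprod_comp_coprodProj_self (k : J) :
    compFunctor (eraseCoprod C k) (coprodProj C k) = unitFunctor (coprod C) (C k) :=
  (liftCoprod_comp_coprodProj _ _ _ _ _ k).trans (eraseComponent_self k)

lemma eraseCoprod_comp_coprodProj_of_ne {j k : J} (h : j ≠ k) :
    compFunctor (eraseCoprod C k) (coprodProj C j) = coprodProj C j :=
  (liftCoprod_comp_coprodProj _ _ _ _ _ j).trans (eraseComponent_of_ne h)

lemma incl_comp_coprodProj_self (k : J) :
    compFunctor (incl C k) (coprodProj C k) = idFunctor (C k) :=
  (toCoprod_comp_coprodProj _ _ k).trans (delta_self C k)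

lemma incl_comp_coprodProj_of_ne {j k : J} (h : j ≠ k) :
    compFunctor (incl C j) (coprodProj C k) = unitFunctor (C j) (C k) :=
  (toCoprod_comp_coprodProj _ _ k).trans (delta_of_ne C h)

lemma incl_comp_eraseCoprod_self (k j : J) :
    compFunctor (compFunctor (incl C k) (eraseCoprod C k)) (coprodProj C j) =
      compFunctor (unitFunctor (C k) (coprod C)) (coprodProj C j) := by
  rw [compFunctor_assoc, unitFunctor_comp_coprodProj]
  rcases eq_or_ne j k with rfl | h
  · rw [eraseCoprod_comp_coprodProj_self, compFunctor_unitFunctor]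
  · rw [eraseCoprod_comp_coprodProj_of_ne h, incl_comp_coprodProj_of_ne h.symm]

lemma incl_comp_eraseCoprod_of_ne {j k : J} (h : j ≠ k) (i : J) :
    compFunctor (compFunctor (incl C j) (eraseCoprod C k)) (coprodProj C i) =
      compFunctor (incl C j) (coprodProj C i) := by
  rw [compFunctor_assoc]
  rcases eq_or_ne i k with rfl | h'
  · rw [eraseCoprod_comp_coprodProj_self, compFunctor_unitFunctor, incl_comp_coprodProj_of_ne h]
  · rw [eraseCoprod_comp_coprodProj_of_ne h']

end Coproduct
end SymMonCat

namespace SymMonCat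

open Functor.LaxMonoidal Functor.OplaxMonoidal Filter

section Unitors

variable {A : Type u} [Category.{v} A] [MonoidalCategory A] {a b c : A}

lemma isUnitId_leftUnitor_inv_comp {u : 𝟙_ A ⟶ a} {v : c ⟶ b} (hu : IsEqToHom u)
    (hv : IsEqToHom v) (hc : c = 𝟙_ A) :
    IsUnitId ((λ_ c).inv ≫ (u ⊗ₘ v) ≫ (unitTensorIso a b).hom) := by
  obtain ⟨rfl, rfl⟩ := hu
  obtain ⟨rfl, rfl⟩ := hv
  subst hc
  exact ⟨rfl, unitTensor_unit rfl rfl, by simp [unitTensorIso_unit]⟩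

variable {f : c ⟶ unitTensor a b}

lemma rightUnitor_inv_comp_eq_rightUnitor_inv {u : c ⟶ a} {v : 𝟙_ A ⟶ b}
    {p : a ⟶ c} {q : b ⟶ 𝟙_ A} (hf : f = (ρ_ c).inv ≫ (u ⊗ₘ v) ≫ (unitTensorIso a b).hom)
    (hu : IsEqToHom u) (hv : IsEqToHom v) (hp : IsEqToHom p) (hq : IsEqToHom q) :
    f ≫ (unitTensorIso a b).inv ≫ (p ⊗ₘ q) ≫ (unitTensorIso c (𝟙_ A)).hom =
      (unitRightUnitor c).inv := by
  have h₁ : u ≫ p = 𝟙 c := (hu.comp hp).ext (isEqToHom_id c)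
  have h₂ : v ≫ q = 𝟙 (𝟙_ A) := (hv.comp hq).ext (isEqToHom_id _)
  simp [hf, unitRightUnitor, h₁, h₂]

lemma leftUnitor_inv_comp_eq_leftUnitor_inv {u : 𝟙_ A ⟶ a} {v : c ⟶ b}
    {p : a ⟶ 𝟙_ A} {q : b ⟶ c} (hf : f = (λ_ c).inv ≫ (u ⊗ₘ v) ≫ (unitTensorIso a b).hom)
    (hu : IsEqToHom u) (hv : IsEqToHom v) (hp : IsEqToHom p) (hq : IsEqToHom q) :
    f ≫ (unitTensorIso a b).inv ≫ (p ⊗ₘ q) ≫ (unitTensorIso (𝟙_ A) c).hom =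
      (unitLeftUnitor c).inv := by
  have h₁ : u ≫ p = 𝟙 (𝟙_ A) := (hu.comp hp).ext (isEqToHom_id _)
  have h₂ : v ≫ q = 𝟙 c := (hv.comp hq).ext (isEqToHom_id c)
  simp [hf, unitLeftUnitor, h₁, h₂]

lemma leftUnitor_inv_comp_eq_rightUnitor_inv {u : 𝟙_ A ⟶ a} {v : c ⟶ b}
    {p : a ⟶ c} {q : b ⟶ 𝟙_ A} (hf : f = (λ_ c).inv ≫ (u ⊗ₘ v) ≫ (unitTensorIso a b).hom)
    (hu : IsEqToHom u) (hv : IsEqToHom v) (hp : IsEqToHom p) (hq : IsEqToHom q)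
    (hc : c = 𝟙_ A) :
    f ≫ (unitTensorIso a b).inv ≫ (p ⊗ₘ q) ≫ (unitTensorIso c (𝟙_ A)).hom =
      (unitRightUnitor c).inv := by
  subst hc
  rw [unitors_inv_equal] at hf
  exact rightUnitor_inv_comp_eq_rightUnitor_inv hf hu hv hp hq

lemma rightUnitor_inv_comp_eq_leftUnitor_inv {u : c ⟶ a} {v : 𝟙_ A ⟶ b}
    {p : a ⟶ 𝟙_ A} {q : b ⟶ c} (hf : f = (ρ_ c).inv ≫ (u ⊗ₘ v) ≫ (unitTensorIso a b).hom)
    (hu : IsEqToHom u) (hv : IsEqToHom v) (hp : IsEqToHom p) (hq : IsEqToHom q)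
    (hc : c = 𝟙_ A) :
    f ≫ (unitTensorIso a b).inv ≫ (p ⊗ₘ q) ≫ (unitTensorIso (𝟙_ A) c).hom =
      (unitLeftUnitor c).inv := by
  subst hc
  rw [← unitors_inv_equal] at hf
  exact leftUnitor_inv_comp_eq_leftUnitor_inv hf hu hv hp hq

end Unitors

section Coproduct

variable {J : Type w} {C : J → SymMonCat.{max w v, max w u}}

/-- The coprojections as strong functors. -/
noncomputable abbrev inclCoprod (C : J → SymMonCat.{max w v, max w u}) (j : J) :
    StrongFunctor (C j) (coprod C) := incl C j

lemma exists_splitIso_self (C : J → SymMonCat.{max w v, max w u}) (k : J) :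
    ∃ e : compFunctor (idFunctor (coprod C)) (coprodProj C k) ≅
      compFunctor (tensorFunctor (compFunctor (coprodProj C k) (inclCoprod C k)) (eraseCoprod C k))
        (coprodProj C k),
      ∀ c : coprod C,
        ∃ (u : CoprodObj.obj c k ⟶
            CoprodObj.obj ((inclCoprod C k).functor.obj (CoprodObj.obj c k)) k)
          (v : 𝟙_ (C k) ⟶ CoprodObj.obj ((eraseCoprod C k).functor.obj c) k),
          IsEqToHom u ∧ IsEqToHom v ∧
            e.hom.natTrans.app c = (ρ_ (CoprodObj.obj c k)).inv ≫ (u ⊗ₘ v) ≫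
              (unitTensorIso _ _).hom := by
  have hA : compFunctor (compFunctor (coprodProj C k) (inclCoprod C k)) (coprodProj C k) =
      coprodProj C k := by
    rw [compFunctor_assoc, incl_comp_coprodProj_self, compFunctor_id]
  have hB := eraseCoprod_comp_coprodProj_self (C := C) k
  refine ⟨idCompIso _ ≪≫ (tensorCompIso _ _ (coprodProj C k) ≪≫
    tensorFunctorIso (eqToIso hA) (eqToIso hB) ≪≫ tensorUnitFunctorIso _).symm, fun c =>
      ⟨(eqToIso hA).inv.natTrans.app c, (eqToIso hB).inv.natTrans.app c,
        isEqToHom_eqToIso_inv_app hA c, isEqToHom_eqToIso_inv_app hB c, ?_⟩⟩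
  exact (Category.id_comp _).trans (Category.assoc _ _ _)

lemma exists_splitIso_of_ne (C : J → SymMonCat.{max w v, max w u}) {j k : J} (h : j ≠ k) :
    ∃ e : compFunctor (idFunctor (coprod C)) (coprodProj C j) ≅
      compFunctor (tensorFunctor (compFunctor (coprodProj C k) (inclCoprod C k)) (eraseCoprod C k))
        (coprodProj C j),
      ∀ c : coprod C,
        ∃ (u : 𝟙_ (C j) ⟶
            CoprodObj.obj ((inclCoprod C k).functor.obj (CoprodObj.obj c k)) j)
          (v : CoprodObj.obj c j ⟶ CoprodObj.obj ((eraseCoprod C k).functor.obj c) j),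
          IsEqToHom u ∧ IsEqToHom v ∧
            e.hom.natTrans.app c = (λ_ (CoprodObj.obj c j)).inv ≫ (u ⊗ₘ v) ≫
              (unitTensorIso _ _).hom := by
  have hA : compFunctor (compFunctor (coprodProj C k) (inclCoprod C k)) (coprodProj C j) =
      unitFunctor (coprod C) (C j) := by
    rw [compFunctor_assoc, incl_comp_coprodProj_of_ne h.symm, compFunctor_unitFunctor]
  have hB := eraseCoprod_comp_coprodProj_of_ne (C := C) h
  refine ⟨idCompIso _ ≪≫ (tensorCompIso _ _ (coprodProj C j) ≪≫
    tensorFunctorIso (eqToIso hA) (eqToIso hB) ≪≫ unitTensorFunctorIso _).symm, fun c =>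
      ⟨(eqToIso hA).inv.natTrans.app c, (eqToIso hB).inv.natTrans.app c,
        isEqToHom_eqToIso_inv_app hA c, isEqToHom_eqToIso_inv_app hB c, ?_⟩⟩
  exact (Category.id_comp _).trans (Category.assoc _ _ _)

lemma exists_split (C : J → SymMonCat.{max w v, max w u}) (k : J) :
    ∃ e : idFunctor (coprod C) ≅
      tensorFunctor (compFunctor (coprodProj C k) (inclCoprod C k)) (eraseCoprod C k),
      (∀ c : coprod C,
        ∃ (u : CoprodObj.obj c k ⟶
            CoprodObj.obj ((inclCoprod C k).functor.obj (CoprodObj.obj c k)) k)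
          (v : 𝟙_ (C k) ⟶ CoprodObj.obj ((eraseCoprod C k).functor.obj c) k),
          IsEqToHom u ∧ IsEqToHom v ∧ CoprodObj.Hom.app (e.hom.natTrans.app c) k =
            (ρ_ (CoprodObj.obj c k)).inv ≫ (u ⊗ₘ v) ≫ (unitTensorIso _ _).hom) ∧
      ∀ (j : J), j ≠ k → ∀ c : coprod C,
        ∃ (u : 𝟙_ (C j) ⟶
            CoprodObj.obj ((inclCoprod C k).functor.obj (CoprodObj.obj c k)) j)
          (v : CoprodObj.obj c j ⟶ CoprodObj.obj ((eraseCoprod C k).functor.obj c) j),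
          IsEqToHom u ∧ IsEqToHom v ∧ CoprodObj.Hom.app (e.hom.natTrans.app c) j =
            (λ_ (CoprodObj.obj c j)).inv ≫ (u ⊗ₘ v) ≫ (unitTensorIso _ _).hom := by
  classical
  obtain ⟨e, he⟩ := exists_splitIso_self C k
  choose e' he' using fun (j : J) (h : j ≠ k) => exists_splitIso_of_ne C h
  let E (j : J) : compFunctor (idFunctor (coprod C)) (coprodProj C j) ≅
      compFunctor (tensorFunctor (compFunctor (coprodProj C k) (inclCoprod C k)) (eraseCoprod C k))
        (coprodProj C j) := if h : j = k then h ▸ e else e' j h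
  have hE : E k = e := dif_pos rfl
  have hE' (j : J) (h : j ≠ k) : E j = e' j h := dif_neg h
  refine ⟨coprodIso E fun c => ?_, fun c => ?_, fun j h c => ?_⟩
  · filter_upwards [CoprodObj.finite c, (Set.finite_singleton k).compl_mem_cofinite] with j hc hj
    rw [hE' j hj]
    obtain ⟨u, v, hu, hv, h⟩ := he' j hj c
    exact h ▸ isUnitId_leftUnitor_inv_comp hu hv hc
  · obtain ⟨u, v, hu, hv, h⟩ := he c
    rw [← hE] at h
    exact ⟨u, v, hu, hv, h⟩
  · obtain ⟨u, v, hu, hv, h'⟩ := he' j h c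
    rw [← hE' j h] at h'
    exact ⟨u, v, hu, hv, h'⟩

lemma isEqToHom_delta_η (C : J → SymMonCat.{max w v, max w u}) (j k : J) :
    IsEqToHom (η (delta C j k).functor) := by
  rcases eq_or_ne j k with rfl | h
  · rw [delta_self]
    exact ⟨rfl, rfl⟩
  · rw [delta_of_ne C h]
    exact ⟨rfl, rfl⟩

lemma incl_obj_of_ne {j k : J} (h : j ≠ k) (x : C j) :
    CoprodObj.obj ((inclCoprod C j).functor.obj x) k = 𝟙_ (C k) :=
  congrArg (fun F : StrongFunctor (C j) (C k) => F.functor.obj x) (delta_of_ne C h)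

lemma isEqToHom_incl_map {j k : J} {x y : C j} {f : x ⟶ y} (hf : IsEqToHom f) :
    IsEqToHom (CoprodObj.Hom.app ((inclCoprod C j).functor.map f) k) :=
  IsEqToHom.map (compFunctor (inclCoprod C j) (coprodProj C k)).functor hf

/-- The decomposition of the coproduct. -/
noncomputable def coprodDecomposition [DecidableEq J] (C : J → SymMonCat.{max w v, max w u}) :
    Decomposition C (coprod C) where
  incl := inclCoprod C
  proj := coprodProj C
  erase := eraseCoprod C
  supp s _ _ f := ∀ j ∉ s, IsUnitId (CoprodObj.Hom.app f j)
  supp_comp hf hg j hj := (hf j hj).comp (hg j hj)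
  supp_source hf j hj := isUnitId_id (hf j hj).1
  supp_target hf j hj := isUnitId_id (hf j hj).2.1
  supp_mono h _ _ _ hf j hj := hf j fun hs => hj (h hs)
  supp_inter {s t _ _ _} hs ht j hj := by
    by_cases h : j ∈ s
    · exact ht j fun h' => hj (Finset.mem_inter.2 ⟨h, h'⟩)
    · exact hs j h
  exists_supp f := ⟨(CoprodObj.Hom.finite f).toFinset, fun j hj =>
    by_contra fun h => hj ((Set.Finite.mem_toFinset _).2 h)⟩
  supp_tensorHom hf hg j hj := isUnitId_tensor (hf j hj) (hg j hj)
  supp_leftUnitor j _ := isUnitId_leftUnitor rfl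
  supp_incl j _ _ f k hk :=
    isUnitId_map (delta_of_ne C (Ne.symm (by simpa using hk))) f
  supp_erase hf j hj := isUnitId_eraseComponent_map fun h => hf j (by simp [h, hj])
  supp_erase_ε k s j _ := isUnitId_eraseComponent_ε k j
  supp_erase_μ hc hd j hj := isUnitId_eraseComponent_μ
    (fun h => (hc j (by simp [h, hj])).1) (fun h => (hd j (by simp [h, hj])).1)
  eq_of_supp_empty hf hg := CoprodObj.hom_ext fun j => by
    obtain ⟨h₁, h₂, h₃⟩ := hf j (Finset.notMem_empty j)
    obtain ⟨h₄, h₅, h₆⟩ := hg j (Finset.notMem_empty j)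
    rw [h₃, h₆]
  exists_unitIso {c} hc :=
    have h (j : J) : CoprodObj.obj c j = 𝟙_ (C j) := (hc j (Finset.notMem_empty j)).1
    ⟨CoprodObj.mkIso (fun j => eqToIso (h j)) (Eventually.of_forall fun j => ⟨h j, rfl, rfl⟩),
      fun j _ => ⟨h j, rfl, rfl⟩⟩
  split k := (exists_split C k).choose
  supp_split {k s} hk {c} hc j hj := by
    obtain ⟨u, v, hu, hv, h⟩ := (exists_split C k).choose_spec.2 j (fun h => hj (h ▸ hk)) c
    rw [h]
    exact isUnitId_leftUnitor_inv_comp hu hv (hc j hj).1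
  inclProj k := eqToIso (incl_comp_coprodProj_self k)
  inclProjNe h := eqToIso (incl_comp_coprodProj_of_ne h)
  inclErase k := coprodIsoOfEq (incl_comp_eraseCoprod_self k)
  inclEraseNe h := coprodIsoOfEq (incl_comp_eraseCoprod_of_ne h)
  supp_inclErase k x j _ :=
    (isEqToHom_coprodIsoOfEq (incl_comp_eraseCoprod_self k) x j).isUnitId_of_target rfl
  supp_inclEraseNe {j k} h x i hi :=
    (isEqToHom_coprodIsoOfEq (incl_comp_eraseCoprod_of_ne h) x i).isUnitId_of_target
      (incl_obj_of_ne (Ne.symm (by simpa using hi)) x)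
  split_incl k x := by
    apply CoprodObj.hom_ext
    intro j
    have hp := isEqToHom_incl_map (k := j)
      (isEqToHom_eqToHom_app (incl_comp_coprodProj_self (C := C) k) x)
    have hq := isEqToHom_coprodIsoOfEq (incl_comp_eraseCoprod_self (C := C) k) x j
    rcases eq_or_ne j k with rfl | h
    · obtain ⟨u, v, hu, hv, h⟩ := (exists_split C j).choose_spec.1 ((inclCoprod C j).functor.obj x)
      exact rightUnitor_inv_comp_eq_rightUnitor_inv h hu hv hp hq
    · obtain ⟨u, v, hu, hv, h'⟩ := (exists_split C k).choose_spec.2 j h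
        ((inclCoprod C k).functor.obj x)
      exact leftUnitor_inv_comp_eq_rightUnitor_inv h' hu hv hp hq (incl_obj_of_ne h.symm x)
  split_incl_ne {j k} h x := by
    apply CoprodObj.hom_ext
    intro i
    have hp := (isEqToHom_incl_map (k := i)
      (isEqToHom_eqToHom_app (incl_comp_coprodProj_of_ne (C := C) h) x)).comp
        (isEqToHom_delta_η C k i)
    have hq := isEqToHom_coprodIsoOfEq (incl_comp_eraseCoprod_of_ne (C := C) h) x i
    rcases eq_or_ne i k with rfl | hi
    · obtain ⟨u, v, hu, hv, h'⟩ := (exists_split C i).choose_spec.1 ((inclCoprod C j).functor.obj x)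
      exact rightUnitor_inv_comp_eq_leftUnitor_inv h' hu hv hp hq (incl_obj_of_ne h x)
    · obtain ⟨u, v, hu, hv, h'⟩ := (exists_split C k).choose_spec.2 i hi
        ((inclCoprod C j).functor.obj x)
      exact leftUnitor_inv_comp_eq_leftUnitor_inv h' hu hv hp hq

end Coproduct
end SymMonCat

theorem mainTheorem8 (J : Type w) (C : J → SymMonCat.{max w v, max w u}) :
    IsStrictTwoProduct (SymMonCat.proj C) ∧ IsTwoCoproduct (SymMonCat.incl C) := by
  classical
  exact ⟨SymMonCat.isStrictTwoProduct_proj C, (SymMonCat.coprodDecomposition C).isTwoCoproduct⟩
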